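/- Let $X$ be a locally compact Hausdorff space, let $n\ge 1$, and let $\tau=(\tau_1,\dots,\tau_n)$ be a tuple of continuous maps $\tau_i:X\to X$. A covariant representation of $\tau$ is a $*$-representation $\pi$ of $C_0(X)$ on a Hilbert space together with contractions $S_1,\dots,S_n$ such that $\pi(f)S_i=S_i\pi(f\circ\tau_i)$ for all $f\in C_0(X)$ and all $i$, in the sense that $\pi(f)S_i\pi(g)=S_i\pi((f\circ\tau_i)g)$ for all $f,g\in C_0(X)$. The semicrossed product $C_0(X)\times_\tau\mathbb F_n^+$ is the universal operator algebra for covariant representations: the norm closed algebra generated by the elements $f$ and $S_if$ $(f\in C_0(X),\ 1\le i\le n)$ in the direct sum of all covariant representations. (If $X$ is compact, it contains $S_i=S_i1$.) For a single map $\tau_i$ this is Peters' semicrossed product $A_i=C_0(X)\times_{\tau_i}\mathbb Z^+$, and $C_0(X)$ is a subalgebra of each $A_i$. The universal free product $*_{C_0(X)}A_i$ with amalgamation over $C_0(X)$ is the norm closed algebra generated by the $A_i$ in the direct sum of all families of completely contractive representations of $A_1,\dots,A_n$ on a common Hilbert space that agree on $C_0(X)$. It has the universal property of the amalgamated free product: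 the canonical maps $\iota_i:A_i\to *_{C_0(X)}A_i$ are completely isometric homomorphisms which agree on $C_0(X)$, and for every operator algebra $B$ and all completely contractive homomorphisms $\pi_i:A_i\to B$ that agree on $C_0(X)$ there is a unique completely contractive homomorphism $\phi:*_{C_0(X)}A_i\to B$ with $\phi\circ\iota_i=\pi_i$ for all $i$. Then $C_0(X)\times_\tau\mathbb F_n^+$ is completely isometrically isomorphic to $*_{C_0(X)}(C_0(X)\times_{\tau_i}\mathbb Z^+)$, by an isomorphism that maps $f$ to $\iota_i(f)$ and $S_if$ to $\iota_i(S_if)$ for all $f\in C_0(X)$ and all $i$. -/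

import Mathlib

open scoped ENNReal ZeroAtInfty

universe u v w

noncomputable section

/-! ### Concrete operator algebras and their matrix norms -/

/-- The algebra of bounded operators on `K`. -/
abbrev BOp (K : Type v) [NormedAddCommGroup K] [InnerProductSpace ℂ K] : Type v := K →L[ℂ] K

section OperatorAlgebras

variable {K : Type v} [NormedAddCommGroup K] [InnerProductSpace ℂ K]
variable {H : Type w} [NormedAddCommGroup H] [InnerProductSpace ℂ H]

/-- The operator on the Hilbert space `K ⊕ ⋯ ⊕ K` (`k` summands) defined by a `k × k` matrix of
operators on `K`. -/
def opMatrix {k : ℕ} (M : Matrix (Fin k) (Fin k) (BOp K)) :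
    PiLp 2 (fun _ : Fin k => K) →L[ℂ] PiLp 2 (fun _ : Fin k => K) :=
  (PiLp.continuousLinearEquiv 2 ℂ (fun _ : Fin k => K)).symm.toContinuousLinearMap ∘L
    (ContinuousLinearMap.pi fun i => ∑ j, M i j ∘L ContinuousLinearMap.proj j) ∘L
    (PiLp.continuousLinearEquiv 2 ℂ (fun _ : Fin k => K)).toContinuousLinearMap

/-- The norm on `k × k` matrices over an algebra `A` of operators on `K`: the operator norm on
`K ⊕ ⋯ ⊕ K`. -/
def matNorm (A : NonUnitalSubalgebra ℂ (BOp K)) {k : ℕ} (M : Matrix (Fin k) (Fin k) A) : ℝ :=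
  ‖opMatrix (M.map fun a => (a : BOp K))‖

/-- A homomorphism between algebras of operators is completely contractive if all its
amplifications to matrices are contractive. -/
def CompletelyContractive {A : NonUnitalSubalgebra ℂ (BOp K)}
    {B : NonUnitalSubalgebra ℂ (BOp H)} (φ : A →ₙₐ[ℂ] B) : Prop :=
  ∀ (k : ℕ) (M : Matrix (Fin k) (Fin k) A), matNorm B (M.map φ) ≤ matNorm A M

/-- A homomorphism between algebras of operators is completely isometric if all its
amplifications to matrices are isometric. -/
def CompletelyIsometric {A : NonUnitalSubalgebra ℂ (BOp K)}
    {B : NonUnitalSubalgebra ℂ (BOp H)} (φ : A →ₙₐ[ℂ] B) : Prop :=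
  ∀ (k : ℕ) (M : Matrix (Fin k) (Fin k) A), matNorm B (M.map φ) = matNorm A M

theorem norm_le_norm_opMatrix_one (T : BOp K) :
    ‖T‖ ≤ ‖opMatrix (k := 1) (fun _ _ => T)‖ := by
  refine T.opNorm_le_bound (ContinuousLinearMap.opNorm_nonneg _) fun x => ?_
  have h := (opMatrix (k := 1) (fun _ _ => T)).le_opNorm (WithLp.toLp 2 fun _ => x)
  simpa [opMatrix, PiLp.norm_eq_of_L2] using h

end OperatorAlgebras

/-! ### Direct sums of bounded families of operators -/

section DirectSums

variable {J : Type v} {E : J → Type u} [∀ j, NormedAddCommGroup (E j)]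
  [∀ j, InnerProductSpace ℂ (E j)]

/-- The operator `⨁ j, T j` on the Hilbert space direct sum of the spaces `E j`, for a uniformly
bounded family of operators `T j` on `E j`. -/
def directSum (T : ∀ j, BOp (E j)) (hT : ∃ C, ∀ j, ‖T j‖ ≤ C) : BOp (lp E 2) :=
  lp.mapCLM 2 T (le_max_right hT.choose 0) fun j => (hT.choose_spec j).trans (le_max_left _ _)

@[simp]
theorem directSum_apply (T : ∀ j, BOp (E j)) (hT : ∃ C, ∀ j, ‖T j‖ ≤ C) (x : lp E 2) (j : J) :
    directSum T hT x j = T j (x j) := rfl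

/-- The direct sum of a pointwise bounded family of representations of an algebra. -/
def directSumRep {B : Type*} [NonUnitalRing B] [Module ℂ B] (π : ∀ j, B →ₙₐ[ℂ] (BOp (E j)))
    (hπ : ∀ b, ∃ C, ∀ j, ‖π j b‖ ≤ C) : B →ₙₐ[ℂ] BOp (lp E 2) where
  toFun b := directSum (fun j => π j b) (hπ b)
  map_smul' c b := by ext; simp
  map_zero' := by ext; simp
  map_add' a b := by ext; simp
  map_mul' a b := by ext; simp

end DirectSums

/-! ### Semicrossed products -/

section SemicrossedProducts

variable {X : Type u} [TopologicalSpace X]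

/-- The function `(f ∘ τ) * g`. It vanishes at infinity since `g` does and `f ∘ τ` is bounded. -/
def compMul (τ : C(X, X)) (f g : C₀(X, ℂ)) : C₀(X, ℂ) where
  toFun x := f (τ x) * g x
  continuous_toFun := by fun_prop
  zero_at_infty' := by
    refine squeeze_zero_norm (a := fun x => ‖f‖ * ‖g x‖) (fun x => ?_) ?_
    · rw [norm_mul]
      gcongr
      exact f.toBCF.norm_coe_le_norm (τ x)
    · simpa using (g.zero_at_infty'.norm).const_mul ‖f‖

variable {ι : Type}

/-- A covariant representation of the maps `τ i`: a `*`-representation `π` of `C₀(X)` on a Hilbert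
space together with contractions `S i` such that `π f * S i = S i * π (f ∘ τ i)`.

The function `f ∘ τ i` is bounded and continuous but need not vanish at infinity (`τ i` need not be
proper), so it acts as a multiplier of `C₀(X)`, and the relation is written out on the vectors
`π g ξ`. These span a dense subspace if `π` is nondegenerate. In general the relation makes the closed
span of these vectors invariant under `S i`, and only this invariant subspace matters below. -/
structure CovariantRep (τ : ι → C(X, X)) : Type (u + 1) where
  /-- the Hilbert space -/
  H : Type u
  [instNormed : NormedAddCommGroup H]
  [instInner : InnerProductSpace ℂ H]
  [instComplete : CompleteSpace H]
  /-- the representation of the functions -/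
  π : C₀(X, ℂ) →⋆ₙₐ[ℂ] (BOp H)
  /-- the contractions -/
  S : ι → (BOp H)
  norm_S_le : ∀ i, ‖S i‖ ≤ 1
  covariance : ∀ i f g, π f * S i * π g = S i * π (compMul (τ i) f g)

attribute [instance] CovariantRep.instNormed CovariantRep.instInner CovariantRep.instComplete

variable (τ : ι → C(X, X))

/-- The Hilbert space of the direct sum of all covariant representations. -/
abbrev UniversalSpace : Type (u + 1) := lp (fun R : CovariantRep τ => R.H) 2

/-- The direct sum of the representations of `C₀(X)` in all covariant representations. -/
def univRep : C₀(X, ℂ) →ₙₐ[ℂ] BOp (UniversalSpace τ) :=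
  directSumRep (fun R : CovariantRep τ => (R.π : C₀(X, ℂ) →ₙₐ[ℂ] (BOp R.H)))
    fun f => ⟨‖f‖, fun R => NonUnitalStarAlgHom.norm_apply_le R.π f⟩

/-- The direct sum of the `i`-th contractions of all covariant representations. -/
def univS (i : ι) : BOp (UniversalSpace τ) :=
  directSum (fun R : CovariantRep τ => R.S i) ⟨1, fun R => R.norm_S_le i⟩

/-- The semicrossed product of `C₀(X)` by the maps `τ i`: the norm closed algebra generated by the
elements `f` and `S i * f`, for `f` in `C₀(X)`, in the direct sum of all covariant representations.
It is the closed span of the elements `S i₁ * ⋯ * S iₘ * f`. If `X` is compact it contains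
`S i * 1` (which is `S i` if `1` acts as the identity), otherwise `S i` is a multiplier of it.

For a single map this is Peters' semicrossed product. -/
def semicrossedProduct : NonUnitalSubalgebra ℂ (BOp (UniversalSpace τ)) :=
  (NonUnitalAlgebra.adjoin ℂ
    (Set.range (univRep τ) ∪ ⋃ i, Set.range fun f => univS τ i * univRep τ f)).topologicalClosure

theorem univRep_mem (f : C₀(X, ℂ)) : univRep τ f ∈ semicrossedProduct τ :=
  NonUnitalSubalgebra.le_topologicalClosure _
    (NonUnitalAlgebra.subset_adjoin ℂ (Or.inl ⟨f, rfl⟩))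

theorem univS_mul_mem (i : ι) (f : C₀(X, ℂ)) :
    univS τ i * univRep τ f ∈ semicrossedProduct τ :=
  NonUnitalSubalgebra.le_topologicalClosure _
    (NonUnitalAlgebra.subset_adjoin ℂ (Or.inr (Set.mem_iUnion.2 ⟨i, f, rfl⟩)))

/-- The inclusion of `C₀(X)` in the semicrossed product. -/
def semicrossedProduct.coeff : C₀(X, ℂ) →ₙₐ[ℂ] semicrossedProduct τ :=
  NonUnitalAlgHom.codRestrict (univRep τ) _ (univRep_mem τ)

/-- The element `S i * f` of the semicrossed product. -/
def semicrossedProduct.gen (i : ι) (f : C₀(X, ℂ)) : semicrossedProduct τ :=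
  ⟨univS τ i * univRep τ f, univS_mul_mem τ i f⟩

/-- Peters' semicrossed product of `C₀(X)` by a single map `σ`. -/
abbrev petersSemicrossedProduct (σ : C(X, X)) :=
  semicrossedProduct fun _ : Unit => σ

end SemicrossedProducts

/-! ### Free products with amalgamation -/

section FreeProducts

variable {ι : Type} {D : Type u} [NonUnitalRing D] [Module ℂ D]
variable {K : ι → Type v} [∀ i, NormedAddCommGroup (K i)] [∀ i, InnerProductSpace ℂ (K i)]
variable (A : ∀ i, NonUnitalSubalgebra ℂ (BOp (K i))) (δ : ∀ i, D →ₙₐ[ℂ] A i)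

/-- A family of completely contractive representations of the algebras `A i` on one Hilbert space
that agree on the common subalgebra `D` (embedded in `A i` by `δ i`). -/
structure AmalgamatedRep : Type (max v (w + 1)) where
  /-- the Hilbert space -/
  H : Type w
  [instNormed : NormedAddCommGroup H]
  [instInner : InnerProductSpace ℂ H]
  [instComplete : CompleteSpace H]
  /-- the representations -/
  π : ∀ i, A i →ₙₐ[ℂ] (BOp H)
  contractive : ∀ i (k : ℕ) (M : Matrix (Fin k) (Fin k) (A i)),
    ‖opMatrix (M.map (π i))‖ ≤ matNorm (A i) M
  agree : ∀ i j d, π i (δ i d) = π j (δ j d)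

attribute [instance] AmalgamatedRep.instNormed AmalgamatedRep.instInner
  AmalgamatedRep.instComplete

/-- The direct sum of the representations of `A i` in all amalgamated families of representations
on Hilbert spaces. -/
def freeRep (i : ι) : A i →ₙₐ[ℂ]
    BOp (lp (fun R : AmalgamatedRep.{u, v, w} A δ => R.H) 2) :=
  directSumRep (fun R : AmalgamatedRep.{u, v, w} A δ => R.π i) fun a =>
    ⟨matNorm (A i) (k := 1) (fun _ _ => a), fun R =>
      (norm_le_norm_opMatrix_one _).trans (R.contractive i 1 fun _ _ => a)⟩

/-- The universal free product of the operator algebras `A i` with amalgamation over `D`: the norm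
closed algebra generated by the algebras `A i` in the direct sum of all amalgamated families of
completely contractive representations on Hilbert spaces. -/
def freeProduct : NonUnitalSubalgebra ℂ
    (BOp (lp (fun R : AmalgamatedRep.{u, v, w} A δ => R.H) 2)) :=
  (NonUnitalAlgebra.adjoin ℂ (⋃ i, Set.range (freeRep.{u, v, w} A δ i))).topologicalClosure

theorem freeRep_mem (i : ι) (a : A i) : freeRep.{u, v, w} A δ i a ∈ freeProduct.{u, v, w} A δ :=
  NonUnitalSubalgebra.le_topologicalClosure _
    (NonUnitalAlgebra.subset_adjoin ℂ (Set.mem_iUnion.2 ⟨i, a, rfl⟩))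

/-- The canonical homomorphism of `A i` to the free product. -/
def freeProduct.incl (i : ι) : A i →ₙₐ[ℂ] freeProduct.{u, v, w} A δ :=
  NonUnitalAlgHom.codRestrict (freeRep.{u, v, w} A δ i) _ (freeRep_mem A δ i)

/-- The universal property of the free product with amalgamation over `D`, for completely
contractive homomorphisms into operator algebras, that is, norm closed algebras of operators on
Hilbert spaces. -/
def IsAmalgamatedFreeProduct {L : Type v} [NormedAddCommGroup L] [InnerProductSpace ℂ L]
    (F : NonUnitalSubalgebra ℂ (BOp L)) (incl : ∀ i, A i →ₙₐ[ℂ] F) : Prop :=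
  IsClosed (F : Set (BOp L)) ∧
  (∀ i, CompletelyIsometric (incl i)) ∧
  (∀ i j d, incl i (δ i d) = incl j (δ j d)) ∧
  ∀ (H : Type w) [NormedAddCommGroup H] [InnerProductSpace ℂ H] [CompleteSpace H]
    (B : NonUnitalSubalgebra ℂ (BOp H)), IsClosed (B : Set (BOp H)) →
    ∀ π : ∀ i, A i →ₙₐ[ℂ] B, (∀ i, CompletelyContractive (π i)) →
      (∀ i j d, π i (δ i d) = π j (δ j d)) →
      ∃! φ : F →ₙₐ[ℂ] B, CompletelyContractive φ ∧ ∀ i a, φ (incl i a) = π i a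

end FreeProducts

end

/-! On generators, a covariant representation of `τ` and a family of completely contractive
representations of the algebras `A i` that agree on `C₀(X)` are the same data on the same Hilbert
space. Given `(π, S)`, each pair `(π, S i)` is covariant for `τ i`, so it is one of the summands on
which `A i` acts, and compression to it represents `A i` (`CovariantRep.toAmalgamatedRep`).
Conversely, the common restriction of a family to `C₀(X)` is contractive, hence a `*`-representation
(`map_star_of_contractive`). The images of the elements `S i * f` form a contractive right module
map in `f`, and an approximate unit of `C₀(X)` yields a contraction implementing it
(`exists_contraction_mul_eq`). Covariance then comes from the relation between `f` and `S i * g`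
inside `A i` (`AmalgamatedRep.toCovariantRep`).

Both algebras consist of diagonal operators on a direct sum, so their matrix norms are suprema over
the summands (`norm_opMatrix_le_of_compression_le`). Since the summands match, each side dominates
the other, and the closed algebra generated by the pairs of corresponding generators is the graph of
the isomorphism (`exists_completelyIsometric_of_pairDominated`).

The universal property allows target Hilbert spaces in any universe, while the summands of the free
product live in the universe of `X`. The norm of a `k × k` matrix is tested on `k` vectors at a
time, and these lie in a closed invariant subspace small enough to be such a summand
(`exists_amalgamatedRep_intertwining`). The inclusions of the `A i` are completely isometric because
a covariant representation of `τ i` extends to all of `τ` by zero contractions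
(`CovariantRep.exists_single_eq`). -/

noncomputable section

/-! ### Norm estimates for matrices of operators -/

section MatrixNorms

variable {K : Type*} [NormedAddCommGroup K] [InnerProductSpace ℂ K]
variable {H : Type*} [NormedAddCommGroup H] [InnerProductSpace ℂ H]

@[simp]
theorem opMatrix_apply {k : ℕ} (M : Matrix (Fin k) (Fin k) (BOp K))
    (x : PiLp 2 (fun _ : Fin k => K)) (i : Fin k) : opMatrix M x i = ∑ j, M i j (x j) := by
  simp [opMatrix]

omit [InnerProductSpace ℂ K] [InnerProductSpace ℂ H] in
theorem PiLp.norm_le_norm_of_coord {k : ℕ} (x : PiLp 2 (fun _ : Fin k => K))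
    (y : PiLp 2 (fun _ : Fin k => H)) (h : ∀ i, ‖x i‖ ≤ ‖y i‖) : ‖x‖ ≤ ‖y‖ := by
  rw [PiLp.norm_eq_of_L2, PiLp.norm_eq_of_L2]
  gcongr with i
  exact h i

theorem norm_opMatrix_one (T : BOp K) : ‖opMatrix (k := 1) (fun _ _ => T)‖ = ‖T‖ := by
  refine le_antisymm (ContinuousLinearMap.opNorm_le_bound _ (ContinuousLinearMap.opNorm_nonneg _) fun x => ?_)
    (norm_le_norm_opMatrix_one T)
  rw [PiLp.norm_eq_of_L2, PiLp.norm_eq_of_L2]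
  simpa [opMatrix] using T.le_opNorm (x 0)

/-- A contraction between the spaces compresses matrices contractively. -/
theorem norm_opMatrix_compress_le {k : ℕ} (M : Matrix (Fin k) (Fin k) (BOp K))
    (P : K →L[ℂ] H) (hP : ∀ x, ‖P x‖ ≤ ‖x‖) (V : H →L[ℂ] K) (hV : ∀ x, ‖V x‖ ≤ ‖x‖) :
    ‖opMatrix (M.map fun T => P ∘L T ∘L V)‖ ≤ ‖opMatrix M‖ := by
  refine ContinuousLinearMap.opNorm_le_bound _ (ContinuousLinearMap.opNorm_nonneg _) fun x => ?_
  set y : PiLp 2 (fun _ : Fin k => K) := WithLp.toLp 2 fun j => V (x j) with hy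
  have hyx : ‖y‖ ≤ ‖x‖ := PiLp.norm_le_norm_of_coord _ _ fun i => hV (x i)
  calc ‖opMatrix (M.map fun T => P ∘L T ∘L V) x‖ ≤ ‖opMatrix M y‖ :=
        PiLp.norm_le_norm_of_coord _ _ fun i => by
          simpa [hy, map_sum] using hP (∑ j, M i j (V (x j)))
    _ ≤ ‖opMatrix M‖ * ‖y‖ := ContinuousLinearMap.le_opNorm _ _
    _ ≤ ‖opMatrix M‖ * ‖x‖ := by gcongr

theorem CompletelyContractive.norm_le {A : NonUnitalSubalgebra ℂ (BOp K)}
    {B : NonUnitalSubalgebra ℂ (BOp H)} {φ : A →ₙₐ[ℂ] B} (h : CompletelyContractive φ) (a : A) :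
    ‖φ a‖ ≤ ‖a‖ := by
  have := h 1 (fun _ _ => a)
  unfold matNorm at this
  exact (norm_opMatrix_one (K := H) (φ a)).symm.le.trans
    (this.trans (norm_opMatrix_one (K := K) a).le)

end MatrixNorms

/-! ### Closed generated subalgebras -/

section Generated

variable {R : Type*} [NonUnitalNormedRing R] [NormedSpace ℂ R] [IsScalarTower ℂ R R]
  [SMulCommClass ℂ R R]

theorem NonUnitalAlgebra.topologicalClosure_adjoin_le {s : Set R} {t : NonUnitalSubalgebra ℂ R}
    (h : s ⊆ t) (ht : IsClosed (t : Set R)) : (adjoin ℂ s).topologicalClosure ≤ t :=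
  NonUnitalSubalgebra.topologicalClosure_minimal (adjoin_le h) ht

/-- Induction for closed properties of the elements of a closed generated subalgebra. -/
theorem NonUnitalAlgebra.topologicalClosure_adjoin_induction {s : Set R}
    {p : (adjoin ℂ s).topologicalClosure → Prop}
    (mem : ∀ x (hx : x ∈ s),
      p ⟨x, NonUnitalSubalgebra.le_topologicalClosure _ (subset_adjoin ℂ hx)⟩)
    (zero : p 0) (add : ∀ x y, p x → p y → p (x + y)) (mul : ∀ x y, p x → p y → p (x * y))
    (smul : ∀ (c : ℂ) x, p x → p (c • x)) (closed : IsClosed {x | p x})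
    (x : (adjoin ℂ s).topologicalClosure) : p x := by
  have hadj : ∀ y (hy : y ∈ adjoin ℂ s),
      p ⟨y, NonUnitalSubalgebra.le_topologicalClosure _ hy⟩ := fun y hy => by
    induction hy using NonUnitalAlgebra.adjoin_induction with
    | mem x hx => exact mem x hx
    | add x y _ _ hx hy => exact add _ _ hx hy
    | zero => exact zero
    | mul x y _ _ hx hy => exact mul _ _ hx hy
    | smul c x _ hx => exact smul c _ hx
  have hx : x ∈ closure (Subtype.val ⁻¹' (adjoin ℂ s : Set R) :
      Set (adjoin ℂ s).topologicalClosure) := by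
    rw [closure_subtype, Set.image_preimage_eq_of_subset]
    · exact x.2
    · rintro y hy
      exact ⟨⟨y, NonUnitalSubalgebra.le_topologicalClosure _ hy⟩, rfl⟩
  exact closed.closure_subset_iff.2 (fun y hy => hadj y.1 hy) hx

end Generated

/-! ### Diagonal operators on direct sums -/

section Diagonal

variable {J : Type v} (E : J → Type u) [∀ j, NormedAddCommGroup (E j)]
  [∀ j, InnerProductSpace ℂ (E j)]

open Classical in
/-- The algebra of operators on a direct sum that are direct sums of operators. -/
def diagonalAlgebra : NonUnitalSubalgebra ℂ (BOp (lp E 2)) where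
  carrier := {T | ∀ (j : J) (x : lp E 2), T x j = T (lp.single 2 j (x j)) j}
  add_mem' {S T} hS hT j x := by
    simp only [add_apply, lp.coeFn_add, Pi.add_apply]
    rw [hS, hT]
  zero_mem' j x := by simp
  mul_mem' {S T} hS hT j x := by
    exact (hS j (T x)).trans <| by rw [hT j x]; exact (hS j _).symm
  smul_mem' c T hT j x := by
    simp only [smul_apply, lp.coeFn_smul, Pi.smul_apply]
    rw [hT]

open Classical in
/-- The compression of an operator on a direct sum to the summand `E j`. -/
def compression (j : J) : BOp (lp E 2) →L[ℂ] BOp (E j) :=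
  (ContinuousLinearMap.compL ℂ (E j) (lp E 2) (E j) (lp.evalCLM ℂ E 2 j)) ∘L
    (ContinuousLinearMap.compL ℂ (E j) (lp E 2) (lp E 2)).flip
      (lp.singleContinuousLinearMap ℂ E 2 j)

variable {E}

open Classical in
@[simp]
theorem compression_apply (j : J) (T : BOp (lp E 2)) (x : E j) :
    compression E j T x = T (lp.single 2 j x) j := rfl

theorem mem_diagonalAlgebra {T : BOp (lp E 2)} :
    T ∈ diagonalAlgebra E ↔ ∀ (j : J) (x : lp E 2), T x j = compression E j T (x j) := Iff.rfl

theorem isClosed_diagonalAlgebra : IsClosed (diagonalAlgebra E : Set (BOp (lp E 2))) := by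
  have : (diagonalAlgebra E : Set (BOp (lp E 2))) =
      ⋂ (j : J) (x : lp E 2), {T | lp.evalCLM ℂ E 2 j (T x) = compression E j T (x j)} := by
    ext T
    simp only [SetLike.mem_coe, mem_diagonalAlgebra, Set.mem_iInter]
    rfl
  rw [this]
  exact isClosed_iInter fun j => isClosed_iInter fun x => isClosed_eq (by fun_prop) (by fun_prop)

theorem directSum_mem_diagonalAlgebra (T : ∀ j, BOp (E j)) (hT : ∃ C, ∀ j, ‖T j‖ ≤ C) :
    directSum T hT ∈ diagonalAlgebra E := fun j x => by simp

theorem compression_directSum (T : ∀ j, BOp (E j)) (hT : ∃ C, ∀ j, ‖T j‖ ≤ C) (j : J) :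
    compression E j (directSum T hT) = T j := by
  ext x; simp

/-- Only the left factor has to be diagonal: the `j`-th coordinate of `S (T x)` then depends only on
the `j`-th coordinate of `T x`. -/
theorem compression_mul {S : BOp (lp E 2)} (hS : S ∈ diagonalAlgebra E) (T : BOp (lp E 2))
    (j : J) : compression E j (S * T) = compression E j S * compression E j T := by
  ext x
  exact hS j _

/-- The representation of an algebra of diagonal operators on a summand. -/
def compressionHom {A : NonUnitalSubalgebra ℂ (BOp (lp E 2))} (hA : A ≤ diagonalAlgebra E)
    (j : J) : A →ₙₐ[ℂ] BOp (E j) where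
  toFun a := compression E j a
  map_smul' c a := by simp
  map_zero' := by simp
  map_add' a b := by simp
  map_mul' a b := compression_mul (hA a.2) _ _

theorem norm_opMatrix_compression_le {k : ℕ} (M : Matrix (Fin k) (Fin k) (BOp (lp E 2))) (j : J) :
    ‖opMatrix (M.map (compression E j))‖ ≤ ‖opMatrix M‖ := by
  classical
  exact norm_opMatrix_compress_le M (lp.evalCLM ℂ E 2 j)
    (fun x => lp.norm_apply_le_norm (by simp) x j)
    (lp.singleContinuousLinearMap ℂ E 2 j) (fun x => (lp.norm_single (by simp) j x).le)

omit [∀ j, InnerProductSpace ℂ (E j)] in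
theorem lp.hasSum_norm_sq (x : lp E 2) : HasSum (fun j => ‖x j‖ ^ 2) (‖x‖ ^ 2) := by
  simpa using lp.hasSum_norm (p := 2) (by simp) x

/-- Interchanging the two sums, the squared norm of a `k`-tuple of vectors is the sum over the
summands of the squared norms of the `k`-tuples of coordinates, and a diagonal matrix acts on each
of these separately. -/
theorem norm_opMatrix_le_of_compression_le {k : ℕ} {M : Matrix (Fin k) (Fin k) (BOp (lp E 2))}
    (hM : ∀ i j, M i j ∈ diagonalAlgebra E) {C : ℝ} (hC : 0 ≤ C)
    (h : ∀ j, ‖opMatrix (M.map (compression E j))‖ ≤ C) : ‖opMatrix M‖ ≤ C := by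
  refine ContinuousLinearMap.opNorm_le_bound _ hC fun x => ?_
  refine le_of_sq_le_sq ?_ (by positivity)
  rw [mul_pow, PiLp.norm_sq_eq_of_L2, PiLp.norm_sq_eq_of_L2, Finset.mul_sum]
  have h1 : HasSum (fun j => ∑ i, ‖opMatrix M x i j‖ ^ 2) (∑ i, ‖opMatrix M x i‖ ^ 2) :=
    hasSum_sum fun i _ => lp.hasSum_norm_sq _
  have h2 : HasSum (fun j => ∑ i, C ^ 2 * ‖x i j‖ ^ 2) (∑ i, C ^ 2 * ‖x i‖ ^ 2) :=
    hasSum_sum fun i _ => (lp.hasSum_norm_sq _).mul_left _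
  refine hasSum_le (fun j => ?_) h1 h2
  set y : PiLp 2 (fun _ : Fin k => E j) := WithLp.toLp 2 fun i => x i j with hy
  have h3 := (ContinuousLinearMap.le_opNorm (opMatrix (M.map (compression E j))) y).trans
    (mul_le_mul_of_nonneg_right (h j) (norm_nonneg _))
  have h4 := pow_le_pow_left₀ (norm_nonneg _) h3 2
  rw [mul_pow, PiLp.norm_sq_eq_of_L2, PiLp.norm_sq_eq_of_L2, Finset.mul_sum] at h4
  have h5 : ∀ i, opMatrix M x i j = opMatrix (M.map (compression E j)) y i := fun i => by
    rw [opMatrix_apply, opMatrix_apply, lp.coeFn_sum, Finset.sum_apply]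
    exact Finset.sum_congr rfl fun l _ => hM i l j (x l)
  simp only [h5]
  exact h4

end Diagonal

/-! ### Homomorphisms determined by generators -/

section Pairs

variable {K : Type*} [NormedAddCommGroup K] [InnerProductSpace ℂ K]
variable {H : Type*} [NormedAddCommGroup H] [InnerProductSpace ℂ H]
variable {I : Type*}

/-- The closed algebra generated by the pairs `(a i, b i)`. -/
def pairAlgebra (a : I → BOp K) (b : I → BOp H) : NonUnitalSubalgebra ℂ (BOp K × BOp H) :=
  (NonUnitalAlgebra.adjoin ℂ (Set.range fun i => (a i, b i))).topologicalClosure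

variable {a : I → BOp K} {b : I → BOp H}

theorem pair_mem_pairAlgebra (i : I) : (a i, b i) ∈ pairAlgebra a b :=
  NonUnitalSubalgebra.le_topologicalClosure _ (NonUnitalAlgebra.subset_adjoin ℂ ⟨i, rfl⟩)

theorem snd_mem_of_mem_pairAlgebra {B : NonUnitalSubalgebra ℂ (BOp H)}
    (hB : IsClosed (B : Set (BOp H))) (hb : ∀ i, b i ∈ B) {p : BOp K × BOp H}
    (hp : p ∈ pairAlgebra a b) : p.2 ∈ B := by
  have h : pairAlgebra a b ≤ B.comap (NonUnitalAlgHom.snd ℂ (BOp K) (BOp H)) :=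
    NonUnitalAlgebra.topologicalClosure_adjoin_le (by rintro _ ⟨i, rfl⟩; exact hb i)
      (hB.preimage continuous_snd)
  exact h hp

theorem swap_mem_pairAlgebra {p : BOp K × BOp H} (hp : p ∈ pairAlgebra a b) :
    p.swap ∈ pairAlgebra b a := by
  have h : pairAlgebra a b ≤ (pairAlgebra b a).comap
      ((NonUnitalAlgHom.snd ℂ (BOp K) (BOp H)).prod (NonUnitalAlgHom.fst ℂ (BOp K) (BOp H))) :=
    NonUnitalAlgebra.topologicalClosure_adjoin_le
      (by rintro _ ⟨i, rfl⟩; exact pair_mem_pairAlgebra (a := b) (b := a) i)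
      ((NonUnitalSubalgebra.isClosed_topologicalClosure _).preimage continuous_swap)
  exact h hp

/-- Domination makes the first projection bounded below on the complete pair algebra, so its range
is closed. As a closed subalgebra containing the generators, it is everything. -/
theorem exists_mem_pairAlgebra [CompleteSpace K] [CompleteSpace H]
    (h : ∀ p ∈ pairAlgebra a b, ‖p.2‖ ≤ ‖p.1‖) {x : BOp K}
    (hx : x ∈ (NonUnitalAlgebra.adjoin ℂ (Set.range a)).topologicalClosure) :
    ∃ y, (x, y) ∈ pairAlgebra a b := by
  have hc : IsClosed (pairAlgebra a b : Set (BOp K × BOp H)) :=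
    NonUnitalSubalgebra.isClosed_topologicalClosure _
  have : CompleteSpace (pairAlgebra a b) := hc.completeSpace_coe
  have hanti : AntilipschitzWith 1 (fun p : pairAlgebra a b => (p : BOp K × BOp H).1) := by
    refine AntilipschitzWith.of_le_mul_dist fun p q => ?_
    have := h _ (p - q).2
    rw [NNReal.coe_one, one_mul, Subtype.dist_eq, dist_eq_norm, dist_eq_norm, Prod.norm_def]
    exact max_le le_rfl this
  have hcl := hanti.isClosed_range
    (uniformContinuous_fst.comp uniformContinuous_subtype_val)
  have hrange : Set.range (fun p : pairAlgebra a b => (p : BOp K × BOp H).1) =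
      ((pairAlgebra a b).map (NonUnitalAlgHom.fst ℂ (BOp K) (BOp H)) : Set (BOp K)) := by
    ext y
    simp
  rw [hrange] at hcl
  have := NonUnitalAlgebra.topologicalClosure_adjoin_le (R := BOp K) (s := Set.range a)
    (by rintro _ ⟨i, rfl⟩; exact ⟨_, pair_mem_pairAlgebra (b := b) i, rfl⟩) hcl hx
  obtain ⟨p, hp, rfl⟩ := this
  exact ⟨p.2, hp⟩

theorem eq_of_mem_pairAlgebra (h : ∀ p ∈ pairAlgebra a b, ‖p.2‖ ≤ ‖p.1‖) {x : BOp K}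
    {y z : BOp H} (hy : (x, y) ∈ pairAlgebra a b) (hz : (x, z) ∈ pairAlgebra a b) : y = z := by
  have := h _ (sub_mem hy hz)
  simpa [sub_eq_zero] using this

/-- The second components of matrices over `pairAlgebra a b` are dominated by the first ones. -/
def PairDominated (a : I → BOp K) (b : I → BOp H) : Prop :=
  ∀ (k : ℕ) (M : Matrix (Fin k) (Fin k) (BOp K × BOp H)),
    (∀ i j, M i j ∈ pairAlgebra a b) → ‖opMatrix (M.map Prod.snd)‖ ≤ ‖opMatrix (M.map Prod.fst)‖

/-- If matrices over `pairAlgebra a b` have dominated second components, then mapping `a i` to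
`b i` extends to a completely contractive homomorphism on the closed algebra generated by the
elements `a i`. -/
theorem exists_hom_of_pairAlgebra [CompleteSpace K] [CompleteSpace H]
    (h : PairDominated a b)
    {A : NonUnitalSubalgebra ℂ (BOp K)}
    (hA : A = (NonUnitalAlgebra.adjoin ℂ (Set.range a)).topologicalClosure)
    {B : NonUnitalSubalgebra ℂ (BOp H)} (hB : IsClosed (B : Set (BOp H))) (hb : ∀ i, b i ∈ B) :
    ∃ φ : A →ₙₐ[ℂ] B, CompletelyContractive φ ∧
      (∀ x : A, ((x : BOp K), (φ x : BOp H)) ∈ pairAlgebra a b) ∧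
      ∀ (x : A) y, ((x : BOp K), y) ∈ pairAlgebra a b → (φ x : BOp H) = y := by
  subst hA
  have h1 : ∀ p ∈ pairAlgebra a b, ‖p.2‖ ≤ ‖p.1‖ := fun p hp => by
    have := h 1 (fun _ _ => p) fun _ _ => hp
    exact (norm_opMatrix_one p.2).symm.le.trans (this.trans (norm_opMatrix_one p.1).le)
  choose g hg using fun x : (NonUnitalAlgebra.adjoin ℂ (Set.range a)).topologicalClosure =>
    exists_mem_pairAlgebra h1 x.2
  -- The pair algebra is a graph: the second component is unique, so any choice `g` of it respects
  -- the algebra operations.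
  let φ : (NonUnitalAlgebra.adjoin ℂ (Set.range a)).topologicalClosure →ₙₐ[ℂ] B :=
    { toFun := fun x => ⟨g x, snd_mem_of_mem_pairAlgebra hB hb (hg x)⟩
      map_smul' := fun c x => Subtype.ext <|
        eq_of_mem_pairAlgebra h1 (hg (c • x)) (SMulMemClass.smul_mem c (hg x))
      map_zero' := Subtype.ext <| eq_of_mem_pairAlgebra h1 (hg 0) (zero_mem _)
      map_add' := fun x y => Subtype.ext <|
        eq_of_mem_pairAlgebra h1 (hg (x + y)) (add_mem (hg x) (hg y))
      map_mul' := fun x y => Subtype.ext <|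
        eq_of_mem_pairAlgebra h1 (hg (x * y)) (mul_mem (hg x) (hg y)) }
  refine ⟨φ, fun k M => ?_, hg, fun x y hy => eq_of_mem_pairAlgebra h1 (hg x) hy⟩
  exact h k (M.map fun x => ((x : BOp K), g x)) fun i j => hg _

end Pairs

/-! ### Small Hilbert spaces -/

section Small

variable {H : Type v} [NormedAddCommGroup H] [InnerProductSpace ℂ H] [CompleteSpace H]

omit [CompleteSpace H] in
-- Each point of the closure is the limit of a sequence of finite linear combinations, and the
-- sequences of coefficients form a type in universe `u`.
theorem small_topologicalClosure_span {W : Type u} (v : W → H) :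
    Small.{u} (Submodule.span ℂ (Set.range v)).topologicalClosure := by
  let f : (ℕ → (W →₀ ℂ)) → H := fun s =>
    Filter.limUnder Filter.atTop fun m => Finsupp.linearCombination ℂ v (s m)
  suffices h : ((Submodule.span ℂ (Set.range v)).topologicalClosure : Set H) ⊆ Set.range f from
    small_subset h
  intro x hx
  obtain ⟨s, hs, hlim⟩ := mem_closure_iff_seq_limit.1 hx
  have : ∀ m, ∃ c : W →₀ ℂ, Finsupp.linearCombination ℂ v c = s m := fun m => by
    have := hs m
    rw [SetLike.mem_coe, ← Finsupp.range_linearCombination] at this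
    exact this
  choose c hc using this
  refine ⟨c, ?_⟩
  simp only [f, hc]
  exact hlim.limUnder_eq

/-- A closed subspace whose underlying type is small is the range of an isometry from a Hilbert
space in the smaller universe. -/
theorem exists_linearIsometry_range_eq (M : Submodule ℂ H) (hM : IsClosed (M : Set H))
    [Small.{u} M] :
    ∃ (ι : Type u) (V : lp (fun _ : ι => ℂ) 2 →ₗᵢ[ℂ] H), LinearMap.range V.toLinearMap = M := by
  have : CompleteSpace M := hM.completeSpace_coe
  obtain ⟨w, b, hb⟩ := exists_hilbertBasis ℂ M
  let e : w ≃ Shrink.{u} w := equivShrink w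
  let b' : HilbertBasis (Shrink.{u} w) ℂ M :=
    HilbertBasis.mk (v := b ∘ e.symm) (b.orthonormal.comp _ e.symm.injective) (by
      rw [e.symm.surjective.range_comp, b.dense_span])
  refine ⟨Shrink.{u} w, M.subtypeₗᵢ.comp b'.repr.symm.toLinearIsometry, ?_⟩
  ext x
  constructor
  · rintro ⟨y, rfl⟩
    exact (b'.repr.symm y).2
  · intro hx
    exact ⟨b'.repr ⟨x, hx⟩, by simp⟩

end Small

/-! ### Contractive representations of `C₀(X)` -/

section ContractiveRep

variable {X : Type u} [TopologicalSpace X]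
variable {H : Type v} [NormedAddCommGroup H] [InnerProductSpace ℂ H]

/-- The Cayley-type transform `i h / (1 + i h)` of a function `h` with real values. -/
theorem exists_eq_mul_one_add_of_real (h : C₀(X, ℂ)) (hr : ∀ x, (h x).im = 0) :
    ∃ a : C₀(X, ℂ), ‖a‖ ≤ 1 ∧ Complex.I • h = a + a * (Complex.I • h) := by
  have hne : ∀ x, 1 + Complex.I * h x ≠ 0 := fun x hx => by
    have := congrArg Complex.re hx
    simp [hr x] at this
  have hnorm : ∀ x, ‖h x‖ ≤ ‖1 + Complex.I * h x‖ := fun x => by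
    rw [← sq_le_sq₀ (norm_nonneg _) (norm_nonneg _), Complex.sq_norm, Complex.sq_norm,
      Complex.normSq_apply, Complex.normSq_apply]
    simp [hr x]
  have hone : ∀ x, 1 ≤ ‖1 + Complex.I * h x‖ := fun x => by
    refine le_trans ?_ (Complex.abs_re_le_norm _)
    simp [hr x]
  let a : C₀(X, ℂ) :=
    { toFun := fun x => Complex.I * h x / (1 + Complex.I * h x)
      continuous_toFun := Continuous.div (by fun_prop) (by fun_prop) hne
      zero_at_infty' := by
        refine squeeze_zero_norm (a := fun x => ‖h x‖) (fun x => ?_)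
          (by simpa using h.zero_at_infty'.norm)
        rw [norm_div, norm_mul, Complex.norm_I, one_mul]
        exact div_le_self (norm_nonneg _) (hone x) }
  refine ⟨a, ?_, ?_⟩
  · rw [← ZeroAtInftyContinuousMap.norm_toBCF_eq_norm,
      BoundedContinuousFunction.norm_le zero_le_one]
    intro x
    change ‖Complex.I * h x / (1 + Complex.I * h x)‖ ≤ 1
    rw [norm_div, norm_mul, Complex.norm_I, one_mul]
    exact div_le_one_of_le₀ (hnorm x) (norm_nonneg _)
  · ext x
    change Complex.I * h x = Complex.I * h x / (1 + Complex.I * h x) +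
      Complex.I * h x / (1 + Complex.I * h x) * (Complex.I * h x)
    have := hne x
    field_simp

/-- For real `t`, the vector `η = ρ (i t h) ξ` satisfies `η = ρ a (ξ + η)` with `a` in the unit
ball, hence `‖η‖ ≤ ‖ξ + η‖`. Expanding the square bounds a linear function of `t` from below, so its
slope vanishes. The transform avoids adjoining a unit to `C₀(X)`. -/
theorem inner_map_self_im_eq_zero_of_contractive (ρ : C₀(X, ℂ) →ₙₐ[ℂ] BOp H)
    (hρ : ∀ f, ‖ρ f‖ ≤ ‖f‖) (h : C₀(X, ℂ)) (hr : ∀ x, (h x).im = 0) (ξ : H) :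
    (inner ℂ ξ (ρ h ξ)).im = 0 := by
  have key : ∀ t : ℝ, 0 ≤ ‖ξ‖ ^ 2 - 2 * t * (inner ℂ ξ (ρ h ξ)).im := fun t => by
    obtain ⟨a, ha, hae⟩ := exists_eq_mul_one_add_of_real ((t : ℂ) • h) (by simp [hr])
    set η := ρ (Complex.I • (t : ℂ) • h) ξ with hη
    have h1 : η = ρ a (ξ + η) := by
      conv_lhs => rw [hη, hae]
      simp [hη]
    have h2 : ‖η‖ ≤ ‖ξ + η‖ := by
      conv_lhs => rw [h1]
      calc _ ≤ ‖ρ a‖ * ‖ξ + η‖ := ContinuousLinearMap.le_opNorm _ _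
        _ ≤ 1 * ‖ξ + η‖ := by gcongr; exact (hρ a).trans ha
        _ = _ := one_mul _
    have h3 : ‖η‖ ^ 2 ≤ ‖ξ + η‖ ^ 2 := by gcongr
    rw [norm_add_sq (𝕜 := ℂ)] at h3
    have h4 : RCLike.re (inner ℂ ξ η) = - t * (inner ℂ ξ (ρ h ξ)).im := by
      simp [hη]
    rw [h4] at h3
    linarith
  by_contra hne
  -- For this `t` the right side of `key` equals `-1`.
  have := key ((‖ξ‖ ^ 2 + 1) / (2 * (inner ℂ ξ (ρ h ξ)).im))
  have h5 : 2 * ((‖ξ‖ ^ 2 + 1) / (2 * (inner ℂ ξ (ρ h ξ)).im)) * (inner ℂ ξ (ρ h ξ)).im =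
    ‖ξ‖ ^ 2 + 1 := by field_simp
  linarith

/-- A contractive representation of `C₀(X)` on a Hilbert space is a `*`-representation. -/
theorem map_star_of_contractive [CompleteSpace H] (ρ : C₀(X, ℂ) →ₙₐ[ℂ] BOp H)
    (hρ : ∀ f, ‖ρ f‖ ≤ ‖f‖) (f : C₀(X, ℂ)) : ρ (star f) = star (ρ f) := by
  have hsa : ∀ h : C₀(X, ℂ), (∀ x, (h x).im = 0) → IsSelfAdjoint (ρ h) := fun h hr => by
    rw [ContinuousLinearMap.isSelfAdjoint_iff_isSymmetric,
      LinearMap.isSymmetric_iff_inner_map_self_real]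
    intro ξ
    rw [Complex.conj_eq_iff_im, ContinuousLinearMap.coe_coe, ← inner_conj_symm, Complex.conj_im,
      inner_map_self_im_eq_zero_of_contractive ρ hρ h hr ξ, neg_zero]
  have key : ∀ h : C₀(X, ℂ), IsSelfAdjoint h → IsSelfAdjoint (ρ h) := fun h hh =>
    hsa h fun x => Complex.conj_eq_iff_im.1 (DFunLike.congr_fun hh x)
  have h1 := key _ (realPart f).2
  have h2 := key _ (imaginaryPart f).2
  rw [← realPart_add_I_smul_imaginaryPart f]
  simp only [star_add, star_smul, map_add, map_smul, h1.star_eq, h2.star_eq, (realPart f).2.star_eq,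
    (imaginaryPart f).2.star_eq]

/-- Douglas-type factorization: an operator dominated by another one factors through it. -/
theorem exists_contraction_comp_eq [CompleteSpace H] {V : Type*} [AddCommGroup V] [Module ℂ V]
    (L L' : V →ₗ[ℂ] H) (h : ∀ z, ‖L' z‖ ≤ ‖L z‖) :
    ∃ S : BOp H, ‖S‖ ≤ 1 ∧ ∀ z, S (L z) = L' z := by
  let M := (LinearMap.range L).topologicalClosure
  have : CompleteSpace M :=
    (Submodule.isClosed_topologicalClosure (LinearMap.range L)).completeSpace_coe
  let e : V →ₗ[ℂ] M := L.codRestrict M fun z =>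
    Submodule.le_topologicalClosure _ (LinearMap.mem_range_self L z)
  have he : DenseRange e := by
    intro x
    rw [closure_subtype, ← Set.range_comp]
    exact x.2
  have hle : ∀ z, ‖L' z‖ ≤ 1 * ‖e z‖ := fun z => by rw [one_mul]; exact h z
  -- Extend by continuity to the closure of the range of `L`, and by zero on its orthogonal
  -- complement.
  refine ⟨(L'.extendOfNorm e) ∘L M.orthogonalProjectionOnto, ?_, fun z => ?_⟩
  · refine (ContinuousLinearMap.opNorm_comp_le _ _).trans ?_
    exact mul_le_one₀ (LinearMap.opNorm_extendOfNorm_le he zero_le_one hle) (norm_nonneg _)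
      (Submodule.orthogonalProjectionOnto_norm_le M)
  · rw [ContinuousLinearMap.comp_apply]
    have : M.orthogonalProjectionOnto (L z) = e z :=
      Submodule.orthogonalProjectionOnto_mem_subspace_eq_self (e z)
    rw [this, LinearMap.extendOfNorm_eq he ⟨1, hle⟩]

/-- A contractive module map of `C₀(X)` is given by a contraction. -/
theorem exists_contraction_mul_eq [CompleteSpace H] (π : C₀(X, ℂ) →ₙₐ[ℂ] BOp H)
    (s : C₀(X, ℂ) →ₗ[ℂ] BOp H) (hs : ∀ f, ‖s f‖ ≤ ‖f‖) (hmul : ∀ f g, s (f * g) = s f * π g) :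
    ∃ S : BOp H, ‖S‖ ≤ 1 ∧ ∀ f, s f = S * π f := by
  -- The order serves only to provide the approximate unit.
  let _ : PartialOrder C₀(X, ℂ) := CStarAlgebra.spectralOrder _
  have : StarOrderedRing C₀(X, ℂ) := CStarAlgebra.spectralOrderedRing _
  let l := CStarAlgebra.approximateUnit C₀(X, ℂ)
  have hl := CStarAlgebra.increasingApproximateUnit C₀(X, ℂ)
  have hsc : Continuous s := AddMonoidHomClass.continuous_of_bound s 1 (by simpa using hs)
  let L : (C₀(X, ℂ) →₀ H) →ₗ[ℂ] H := Finsupp.lsum ℂ fun f => (π f : H →ₗ[ℂ] H)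
  let L' : (C₀(X, ℂ) →₀ H) →ₗ[ℂ] H := Finsupp.lsum ℂ fun f => (s f : H →ₗ[ℂ] H)
  -- Since `s e * π f = s (e * f)` tends to `s f` along the approximate unit, `L' z` is a limit of
  -- contractions applied to `L z`. This gives the domination needed for the factorization.
  have hlim : ∀ z, Filter.Tendsto (fun e => s e (L z)) l (nhds (L' z)) := fun z => by
    induction z using Finsupp.induction_linear with
    | zero => simp
    | add z z' hz hz' => simpa only [map_add] using hz.add hz'
    | single f ξ =>
      have h1 : ∀ e, s e (L (Finsupp.single f ξ)) = s (e * f) ξ := fun e => by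
        simp [L, hmul]
      have h2 : L' (Finsupp.single f ξ) = s f ξ := by simp [L']
      simp only [h1, h2]
      have h3 : Filter.Tendsto (fun e => s (e * f)) l (nhds (s f)) :=
        (hsc.tendsto f).comp (hl.tendsto_mul_right f)
      exact ((ContinuousLinearMap.apply ℂ H ξ).continuous.tendsto _).comp h3
  have hle : ∀ z, ‖L' z‖ ≤ ‖L z‖ := fun z => by
    have := hl.neBot
    refine le_of_tendsto (hlim z).norm (hl.eventually_norm.mono fun e he => ?_)
    refine (ContinuousLinearMap.le_opNorm _ _).trans ?_
    exact mul_le_of_le_one_left (norm_nonneg _) ((hs e).trans he)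
  obtain ⟨S, hS, hSL⟩ := exists_contraction_comp_eq L L' hle
  refine ⟨S, hS, fun f => ?_⟩
  ext ξ
  simpa [L, L'] using (hSL (Finsupp.single f ξ)).symm

end ContractiveRep

theorem norm_le_of_compression_le {J : Type v} {E : J → Type u} [∀ j, NormedAddCommGroup (E j)]
    [∀ j, InnerProductSpace ℂ (E j)] {T : BOp (lp E 2)} (hT : T ∈ diagonalAlgebra E) {C : ℝ}
    (hC : 0 ≤ C) (h : ∀ j, ‖compression E j T‖ ≤ C) : ‖T‖ ≤ C := by
  rw [← norm_opMatrix_one]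
  refine norm_opMatrix_le_of_compression_le (fun _ _ => hT) hC fun j => ?_
  exact (norm_opMatrix_one (compression E j T)).le.trans (h j)

theorem pairAlgebra_induction {K : Type*} [NormedAddCommGroup K] [InnerProductSpace ℂ K]
    {H : Type*} [NormedAddCommGroup H] [InnerProductSpace ℂ H] {I : Type*} {a : I → BOp K}
    {b : I → BOp H} {p : BOp K × BOp H → Prop} (mem : ∀ i, p (a i, b i)) (zero : p 0)
    (add : ∀ x y, p x → p y → p (x + y)) (mul : ∀ x y, p x → p y → p (x * y))
    (smul : ∀ (c : ℂ) x, p x → p (c • x)) (closed : IsClosed {x | p x})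
    {x : BOp K × BOp H} (hx : x ∈ pairAlgebra a b) : p x :=
  NonUnitalAlgebra.topologicalClosure_adjoin_induction 
    (p := fun x : (NonUnitalAlgebra.adjoin ℂ (Set.range fun i => (a i, b i))).topologicalClosure =>
      p x.1)
    (by rintro _ ⟨i, rfl⟩; exact mem i) zero (fun _ _ => add _ _) (fun _ _ => mul _ _)
    (fun _ _ => smul _ _) (closed.preimage continuous_subtype_val) ⟨x, hx⟩

section DirectSumRep

variable {J : Type v} {E : J → Type u} [∀ j, NormedAddCommGroup (E j)]
  [∀ j, InnerProductSpace ℂ (E j)] {B : Type*} [NonUnitalRing B] [Module ℂ B]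
  (π : ∀ j, B →ₙₐ[ℂ] (BOp (E j))) (hπ : ∀ b, ∃ C, ∀ j, ‖π j b‖ ≤ C) (b : B)

theorem directSumRep_mem_diagonalAlgebra : directSumRep π hπ b ∈ diagonalAlgebra E :=
  directSum_mem_diagonalAlgebra _ (hπ b)

theorem compression_directSumRep (j : J) : compression E j (directSumRep π hπ b) = π j b :=
  compression_directSum _ (hπ b) j

end DirectSumRep

/-! ### Representations of semicrossed products -/

section Semicrossed

variable {X : Type u} [TopologicalSpace X] {ι : Type} (τ : ι → C(X, X))

theorem univRep_mem_diagonalAlgebra (f : C₀(X, ℂ)) :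
    univRep τ f ∈ diagonalAlgebra (fun R : CovariantRep τ => R.H) :=
  directSumRep_mem_diagonalAlgebra _ _ f

theorem univS_mem_diagonalAlgebra (i : ι) :
    univS τ i ∈ diagonalAlgebra (fun R : CovariantRep τ => R.H) :=
  directSum_mem_diagonalAlgebra _ ⟨1, fun R => R.norm_S_le i⟩

@[simp]
theorem compression_univRep (f : C₀(X, ℂ)) (R : CovariantRep τ) :
    compression (fun R : CovariantRep τ => R.H) R (univRep τ f) = R.π f :=
  compression_directSumRep _ _ f R

@[simp]
theorem compression_univS_mul_univRep (i : ι) (f : C₀(X, ℂ)) (R : CovariantRep τ) :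
    compression (fun R : CovariantRep τ => R.H) R (univS τ i * univRep τ f) = R.S i * R.π f := by
  rw [compression_mul (univS_mem_diagonalAlgebra τ i), compression_univRep]
  congr 1
  exact compression_directSum _ ⟨1, fun R => R.norm_S_le i⟩ R

theorem semicrossedProduct_le_diagonalAlgebra :
    semicrossedProduct τ ≤ diagonalAlgebra (fun R : CovariantRep τ => R.H) := by
  refine NonUnitalAlgebra.topologicalClosure_adjoin_le ?_ isClosed_diagonalAlgebra
  rintro _ (⟨f, rfl⟩ | hT)
  · exact univRep_mem_diagonalAlgebra τ f
  · obtain ⟨i, f, rfl⟩ := Set.mem_iUnion.1 hT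
    exact mul_mem (univS_mem_diagonalAlgebra τ i) (univRep_mem_diagonalAlgebra τ f)

variable {τ}

/-- Induction for closed properties of the elements of a semicrossed product. -/
theorem semicrossedProduct.induction {p : semicrossedProduct τ → Prop}
    (coeff : ∀ f, p (coeff τ f)) (gen : ∀ i f, p (gen τ i f))
    (add : ∀ x y, p x → p y → p (x + y)) (mul : ∀ x y, p x → p y → p (x * y))
    (smul : ∀ (c : ℂ) x, p x → p (c • x)) (closed : IsClosed {x | p x})
    (x : semicrossedProduct τ) : p x := by
  have zero : p 0 := by
    have h := smul 0 _ (coeff 0)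
    rwa [show (0 : ℂ) • semicrossedProduct.coeff τ 0 = 0 from Subtype.ext (zero_smul ℂ _)] at h
  refine NonUnitalAlgebra.topologicalClosure_adjoin_induction (p := p) ?_ zero add mul smul closed x
  rintro _ (⟨f, rfl⟩ | hT)
  · exact coeff f
  · obtain ⟨i, f, rfl⟩ := Set.mem_iUnion.1 hT
    exact gen i f

theorem semicrossedProduct.norm_coeff_le (f : C₀(X, ℂ)) : ‖coeff τ f‖ ≤ ‖f‖ := by
  refine norm_le_of_compression_le (univRep_mem_diagonalAlgebra τ f) (norm_nonneg f) fun R => ?_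
  rw [compression_univRep]
  exact NonUnitalStarAlgHom.norm_apply_le R.π f

theorem semicrossedProduct.norm_gen_le (i : ι) (f : C₀(X, ℂ)) : ‖gen τ i f‖ ≤ ‖f‖ := by
  refine norm_le_of_compression_le
    (semicrossedProduct_le_diagonalAlgebra τ (gen τ i f).2) (norm_nonneg f) fun R => ?_
  refine (congrArg norm (compression_univS_mul_univRep τ i f R)).le.trans ?_
  refine (norm_mul_le _ _).trans ?_
  exact (mul_le_of_le_one_left (norm_nonneg _) (R.norm_S_le i)).trans
    (NonUnitalStarAlgHom.norm_apply_le R.π f)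

theorem semicrossedProduct.gen_mul_coeff (i : ι) (f g : C₀(X, ℂ)) :
    gen τ i f * coeff τ g = gen τ i (f * g) :=
  Subtype.ext <| by
    change univS τ i * univRep τ f * univRep τ g = univS τ i * univRep τ (f * g)
    rw [map_mul, mul_assoc]

/-- Covariance holds in every summand. As an identity inside the algebra it survives under arbitrary
homomorphisms, where no operator `S i` is given. -/
theorem semicrossedProduct.coeff_mul_gen (i : ι) (f g : C₀(X, ℂ)) :
    coeff τ f * gen τ i g = gen τ i (compMul (τ i) f g) :=
  Subtype.ext <| by
    change univRep τ f * (univS τ i * univRep τ g) = univS τ i * univRep τ (compMul (τ i) f g)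
    ext x R
    have := DFunLike.congr_fun (R.covariance i f g) (x R)
    exact this

theorem semicrossedProduct.gen_add (i : ι) (f g : C₀(X, ℂ)) :
    gen τ i (f + g) = gen τ i f + gen τ i g :=
  Subtype.ext <| by
    change univS τ i * univRep τ (f + g) = univS τ i * univRep τ f + univS τ i * univRep τ g
    rw [map_add, mul_add]

theorem semicrossedProduct.gen_smul (i : ι) (c : ℂ) (f : C₀(X, ℂ)) :
    gen τ i (c • f) = c • gen τ i f :=
  Subtype.ext <| by
    change univS τ i * univRep τ (c • f) = c • (univS τ i * univRep τ f)
    rw [map_smul, mul_smul_comm]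

/-- A contractive representation of the semicrossed product maps the elements `S i * f` to the
products of a contraction and the images of `f`. -/
theorem semicrossedProduct.exists_contraction_map_gen {H : Type v} [NormedAddCommGroup H]
    [InnerProductSpace ℂ H] [CompleteSpace H] (ρ : semicrossedProduct τ →ₙₐ[ℂ] BOp H)
    (hρ : ∀ a, ‖ρ a‖ ≤ ‖a‖) (i : ι) :
    ∃ S : BOp H, ‖S‖ ≤ 1 ∧ ∀ f, ρ (gen τ i f) = S * ρ (coeff τ f) :=
  exists_contraction_mul_eq (ρ.comp (coeff τ))
    { toFun := fun f => ρ (gen τ i f)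
      map_add' := fun f g => by rw [gen_add, map_add]
      map_smul' := fun c f => by rw [gen_smul, map_smul]; rfl }
    (fun f => (hρ _).trans (norm_gen_le i f)) fun f g => by
      change ρ (gen τ i (f * g)) = ρ (gen τ i f) * ρ (coeff τ g)
      rw [← gen_mul_coeff, map_mul]

/-- The restriction of a covariant representation to one of the maps. -/
abbrev CovariantRep.single (R : CovariantRep τ) (i : ι) : CovariantRep fun _ : Unit => τ i where
  H := R.H
  π := R.π
  S _ := R.S i
  norm_S_le _ := R.norm_S_le i
  covariance _ := R.covariance i

open Classical in
/-- Each covariant representation of one of the maps extends to all maps. -/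
theorem CovariantRep.exists_single_eq (i : ι) (R : CovariantRep fun _ : Unit => τ i) :
    ∃ R' : CovariantRep τ, R'.single i = R := by
  refine ⟨{ H := R.H
            π := R.π
            -- Both sides of the covariance relation vanish for the zero operator.
            S := fun j => if j = i then R.S () else 0
            norm_S_le := fun j => ?_
            covariance := fun j f g => ?_ }, ?_⟩
  · split_ifs
    · exact R.norm_S_le ()
    · simp
  · split_ifs with h
    · subst h; exact R.covariance () f g
    · simp
  · cases R
    simp [CovariantRep.single]

end Semicrossed

theorem norm_opMatrix_compressionHom_le {J : Type v} {E : J → Type u}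
    [∀ j, NormedAddCommGroup (E j)] [∀ j, InnerProductSpace ℂ (E j)]
    {A : NonUnitalSubalgebra ℂ (BOp (lp E 2))} (hA : A ≤ diagonalAlgebra E) (j : J) {k : ℕ}
    (M : Matrix (Fin k) (Fin k) A) : ‖opMatrix (M.map (compressionHom hA j))‖ ≤ matNorm A M :=
  norm_opMatrix_compression_le (M.map fun a => (a : BOp (lp E 2))) j

/-- A closed subspace that is invariant under the images of the generators of a semicrossed
product is invariant. -/
theorem semicrossedProduct.map_mem_of_invariant {X : Type u} [TopologicalSpace X] {ι : Type}
    {τ : ι → C(X, X)} {H : Type v} [NormedAddCommGroup H] [InnerProductSpace ℂ H]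
    {ρ : semicrossedProduct τ →ₙₐ[ℂ] BOp H} (hρ : Continuous ρ) {M : Submodule ℂ H}
    (hM : IsClosed (M : Set H)) (hcoeff : ∀ f, ∀ y ∈ M, ρ (coeff τ f) y ∈ M)
    (hgen : ∀ i f, ∀ y ∈ M, ρ (gen τ i f) y ∈ M) (a : semicrossedProduct τ) :
    ∀ y ∈ M, ρ a y ∈ M := by
  refine semicrossedProduct.induction (p := fun a => ∀ y ∈ M, ρ a y ∈ M) hcoeff hgen ?_ ?_ ?_ ?_ a
  · intro a b ha hb y hy
    rw [map_add]
    exact add_mem (ha y hy) (hb y hy)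
  · intro a b ha hb y hy
    rw [map_mul]
    exact ha _ (hb y hy)
  · intro c a ha y hy
    rw [map_smul]
    exact M.smul_mem c (ha y hy)
  · simp only [Set.ofPred_forall]
    refine isClosed_iInter fun y => isClosed_iInter fun _ => ?_
    exact hM.preimage ((ContinuousLinearMap.apply ℂ H y).continuous.comp hρ)

theorem norm_le_of_opMatrix_le {K : Type*} [NormedAddCommGroup K] [InnerProductSpace ℂ K]
    {H : Type*} [NormedAddCommGroup H] [InnerProductSpace ℂ H]
    {A : NonUnitalSubalgebra ℂ (BOp K)} {ρ : A →ₙₐ[ℂ] BOp H}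
    (h : ∀ M : Matrix (Fin 1) (Fin 1) A, ‖opMatrix (M.map ρ)‖ ≤ matNorm A M) (a : A) :
    ‖ρ a‖ ≤ ‖a‖ :=
  (norm_le_norm_opMatrix_one _).trans
    ((h fun _ _ => a).trans (norm_opMatrix_one (K := K) a).le)

theorem continuous_of_opMatrix_le {K : Type*} [NormedAddCommGroup K] [InnerProductSpace ℂ K]
    {H : Type*} [NormedAddCommGroup H] [InnerProductSpace ℂ H]
    {A : NonUnitalSubalgebra ℂ (BOp K)} {ρ : A →ₙₐ[ℂ] BOp H}
    (h : ∀ M : Matrix (Fin 1) (Fin 1) A, ‖opMatrix (M.map ρ)‖ ≤ matNorm A M) : Continuous ρ :=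
  AddMonoidHomClass.continuous_of_bound ρ 1 fun a => by
    rw [one_mul]
    exact norm_le_of_opMatrix_le h a

/-- Finitely many vectors lie in a closed subspace of small size that is invariant under a small
family of operators. -/
theorem exists_small_invariant_submodule {H : Type v} [NormedAddCommGroup H]
    [InnerProductSpace ℂ H] {G : Type u} (op : G → BOp H) {k : ℕ} (x : Fin k → H) :
    ∃ M : Submodule ℂ H, IsClosed (M : Set H) ∧ Small.{u} M ∧ (∀ j, x j ∈ M) ∧
      ∀ g, ∀ y ∈ M, op g y ∈ M := by
  -- All words in the operators applied to the given vectors. The empty word gives the vectors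
  -- themselves, and prepending a letter gives the invariance.
  let v : List G × Fin k → H := fun s => (s.1.map op).prod (x s.2)
  let M := (Submodule.span ℂ (Set.range v)).topologicalClosure
  have hMc : IsClosed (M : Set H) := Submodule.isClosed_topologicalClosure _
  have hv : ∀ s, v s ∈ M := fun s =>
    Submodule.le_topologicalClosure _ (Submodule.subset_span ⟨s, rfl⟩)
  refine ⟨M, hMc, small_topologicalClosure_span v, fun j => by simpa [v] using hv ([], j),
    fun g => ?_⟩
  have : M ≤ M.comap (op g : H →ₗ[ℂ] H) := by
    refine Submodule.topologicalClosure_minimal _ (Submodule.span_le.2 ?_)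
      (hMc.preimage (op g).continuous)
    rintro _ ⟨s, rfl⟩
    have h1 : op g (v s) = v (g :: s.1, s.2) := by simp [v]
    change op g (v s) ∈ M
    rw [h1]
    exact hv _
  exact this

/-! ### Free products of semicrossed products -/

section FreeProductRep

variable {ι : Type} {D : Type u} [NonUnitalRing D] [Module ℂ D]
variable {K : ι → Type v} [∀ i, NormedAddCommGroup (K i)] [∀ i, InnerProductSpace ℂ (K i)]
variable {A : ∀ i, NonUnitalSubalgebra ℂ (BOp (K i))} {δ : ∀ i, D →ₙₐ[ℂ] A i}

theorem AmalgamatedRep.norm_le (Q : AmalgamatedRep.{u, v, w} A δ) (i : ι) (a : A i) :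
    ‖Q.π i a‖ ≤ ‖a‖ :=
  norm_le_of_opMatrix_le (Q.contractive i 1) a

variable (A δ)

theorem freeRep_mem_diagonalAlgebra (i : ι) (a : A i) : freeRep.{u, v, w} A δ i a ∈
    diagonalAlgebra (fun R : AmalgamatedRep.{u, v, w} A δ => R.H) :=
  directSumRep_mem_diagonalAlgebra _ _ a

@[simp]
theorem compression_freeRep (i : ι) (a : A i) (Q : AmalgamatedRep.{u, v, w} A δ) :
    compression (fun R : AmalgamatedRep.{u, v, w} A δ => R.H) Q (freeRep.{u, v, w} A δ i a) =
      Q.π i a :=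
  compression_directSumRep _ _ a Q

theorem norm_freeRep_le (i : ι) (a : A i) : ‖freeRep.{u, v, w} A δ i a‖ ≤ ‖a‖ := by
  refine norm_le_of_compression_le (freeRep_mem_diagonalAlgebra A δ i a) (norm_nonneg a) fun Q => ?_
  rw [compression_freeRep]
  exact Q.norm_le i a

theorem freeRep_agree (i j : ι) (d : D) :
    freeRep.{u, v, w} A δ i (δ i d) = freeRep.{u, v, w} A δ j (δ j d) := by
  ext x Q
  exact DFunLike.congr_fun (Q.agree i j d) (x Q)

theorem freeProduct_eq_adjoin_range_sigma : freeProduct.{u, v, w} A δ =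
    (NonUnitalAlgebra.adjoin ℂ (Set.range fun s : Σ i, A i =>
      freeRep.{u, v, w} A δ s.1 s.2)).topologicalClosure := by
  rw [freeProduct, Set.range_sigma_eq_iUnion_range]

/-- The bound holds in every summand, by the complete contractivity required of an amalgamated
family. -/
theorem matNorm_incl_le (i : ι) (k : ℕ) (M : Matrix (Fin k) (Fin k) (A i)) :
    matNorm (freeProduct.{u, v, w} A δ) (M.map (freeProduct.incl.{u, v, w} A δ i)) ≤
      matNorm (A i) M := by
  refine norm_opMatrix_le_of_compression_le
    (fun a b => freeRep_mem_diagonalAlgebra A δ i (M a b))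
    (ContinuousLinearMap.opNorm_nonneg _) fun Q => ?_
  refine le_trans (le_of_eq ?_) (Q.contractive i k M)
  congr 2
  funext a b
  exact compression_freeRep A δ i (M a b) Q

/-- An isometry onto a space that is invariant under the algebras `A i` restricts an amalgamated
family of representations. -/
def AmalgamatedRep.ofLinearIsometry {H : Type*} [NormedAddCommGroup H] [InnerProductSpace ℂ H]
    [CompleteSpace H] (π : ∀ i, A i →ₙₐ[ℂ] BOp H)
    (contractive : ∀ i (k : ℕ) (M : Matrix (Fin k) (Fin k) (A i)),
      ‖opMatrix (M.map (π i))‖ ≤ matNorm (A i) M)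
    (agree : ∀ i j d, π i (δ i d) = π j (δ j d))
    {H' : Type w} [NormedAddCommGroup H'] [InnerProductSpace ℂ H'] [CompleteSpace H']
    (V : H' →L[ℂ] H) (P : H →L[ℂ] H') (hV : ∀ ξ, ‖V ξ‖ ≤ ‖ξ‖) (hP : ∀ ξ, ‖P ξ‖ ≤ ‖ξ‖)
    (hinv : ∀ i a ξ, V (P (π i a (V ξ))) = π i a (V ξ)) : AmalgamatedRep.{u, v, w} A δ where
  H := H'
  π i :=
    { toFun := fun a => P ∘L π i a ∘L V
      map_smul' := fun c a => by ext; simp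
      map_zero' := by ext; simp
      map_add' := fun a b => by ext; simp
      -- By `hinv`, the operator `V P` between the two factors acts as the identity.
      map_mul' := fun a b => by ext ξ; simp [hinv] }
  contractive i k M :=
    (norm_opMatrix_compress_le (M.map (π i)) P hP V hV).trans (contractive i k M)
  agree i j d := by
    change P ∘L π i (δ i d) ∘L V = P ∘L π j (δ j d) ∘L V
    rw [agree i j d]

/-- A closed invariant subspace of small size carries a family of representations on a Hilbert space
in the smaller universe. -/
theorem AmalgamatedRep.exists_intertwining {ι : Type} {D : Type u} [NonUnitalRing D] [Module ℂ D]
    {K : ι → Type w} [∀ i, NormedAddCommGroup (K i)] [∀ i, InnerProductSpace ℂ (K i)]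
    {A : ∀ i, NonUnitalSubalgebra ℂ (BOp (K i))} {δ : ∀ i, D →ₙₐ[ℂ] A i}
    {H : Type v} [NormedAddCommGroup H] [InnerProductSpace ℂ H] [CompleteSpace H]
    (π : ∀ i, A i →ₙₐ[ℂ] BOp H)
    (contractive : ∀ i (k : ℕ) (M : Matrix (Fin k) (Fin k) (A i)),
      ‖opMatrix (M.map (π i))‖ ≤ matNorm (A i) M)
    (agree : ∀ i j d, π i (δ i d) = π j (δ j d)) (M : Submodule ℂ H) (hMc : IsClosed (M : Set H))
    [Small.{u} M] (hπ : ∀ i a, ∀ y ∈ M, π i a y ∈ M) :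
    ∃ (Q : AmalgamatedRep.{u, w, u} A δ) (V : Q.H →ₗᵢ[ℂ] H),
      (∀ y ∈ M, ∃ ξ, V ξ = y) ∧ ∀ i a ξ, π i a (V ξ) = V (Q.π i a ξ) := by
  obtain ⟨κ, V, hV⟩ := exists_linearIsometry_range_eq M hMc
  have hmem : ∀ y ∈ M, ∃ ξ, V ξ = y := fun y hy => by
    rw [← hV] at hy
    exact hy
  have hVM : ∀ ξ, V ξ ∈ M := fun ξ => by
    rw [← hV]
    exact ⟨ξ, rfl⟩
  -- The adjoint of the isometry inverts it on its range `M`.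
  let P := ContinuousLinearMap.adjoint V.toContinuousLinearMap
  have hPV : ∀ ξ, P (V ξ) = ξ := fun ξ => by
    refine ext_inner_right ℂ fun η => ?_
    rw [ContinuousLinearMap.adjoint_inner_left]
    exact V.inner_map_map ξ η
  have hVP : ∀ y ∈ M, V (P y) = y := fun y hy => by
    obtain ⟨ξ, rfl⟩ := hmem y hy
    rw [hPV]
  have hP : ∀ y, ‖P y‖ ≤ ‖y‖ := fun y => by
    refine (ContinuousLinearMap.le_opNorm _ _).trans ?_
    rw [LinearIsometryEquiv.norm_map]
    exact mul_le_of_le_one_left (norm_nonneg _) V.norm_toContinuousLinearMap_le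
  exact ⟨AmalgamatedRep.ofLinearIsometry _ _ π contractive agree V.toContinuousLinearMap P
    (fun ξ => (V.norm_map ξ).le) hP fun i a ξ => hVP _ (hπ i a _ (hVM ξ)), V, hmem,
    fun i a ξ => (hVP _ (hπ i a _ (hVM ξ))).symm⟩

end FreeProductRep

/-! ### Covariant representations versus amalgamated families -/

section Peters

variable {X : Type u} [TopologicalSpace X] {ι : Type} (τ : ι → C(X, X))

/-- The semicrossed products of the single maps. -/
abbrev petersFamily (i : ι) := petersSemicrossedProduct (τ i)

/-- The inclusions of `C₀(X)` in the semicrossed products of the single maps. -/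
abbrev petersCoeff (i : ι) : C₀(X, ℂ) →ₙₐ[ℂ] petersFamily τ i :=
  semicrossedProduct.coeff fun _ : Unit => τ i

/-- The elements `S i * f` of the semicrossed product of the map `τ i`. -/
abbrev petersGen (i : ι) (f : C₀(X, ℂ)) : petersFamily τ i :=
  semicrossedProduct.gen (fun _ : Unit => τ i) () f

variable {τ}

/-- Finitely many vectors lie in an invariant subspace on which a family of representations is
equivalent to one on a Hilbert space in the universe of `X`. -/
theorem exists_amalgamatedRep_intertwining {H : Type v} [NormedAddCommGroup H]
    [InnerProductSpace ℂ H] [CompleteSpace H] (π : ∀ i, petersFamily τ i →ₙₐ[ℂ] BOp H)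
    (contractive : ∀ i (k : ℕ) (M : Matrix (Fin k) (Fin k) (petersFamily τ i)),
      ‖opMatrix (M.map (π i))‖ ≤ matNorm (petersFamily τ i) M)
    (agree : ∀ i j d, π i (petersCoeff τ i d) = π j (petersCoeff τ j d)) {k : ℕ} (x : Fin k → H) :
    ∃ (Q : AmalgamatedRep.{u, u + 1, u} (petersFamily τ) (petersCoeff τ)) (V : Q.H →ₗᵢ[ℂ] H),
      (∀ j, ∃ ξ, V ξ = x j) ∧ ∀ i a ξ, π i a (V ξ) = V (Q.π i a ξ) := by
  obtain ⟨M, hMc, hsmall, hx, hop⟩ := exists_small_invariant_submodule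
    (Sum.elim (fun s : Σ _ : ι, C₀(X, ℂ) => π s.1 (petersCoeff τ s.1 s.2))
      fun s : Σ _ : ι, C₀(X, ℂ) => π s.1 (petersGen τ s.1 s.2)) x
  have hπ : ∀ i a, ∀ y ∈ M, π i a y ∈ M := fun i a =>
    semicrossedProduct.map_mem_of_invariant
      (continuous_of_opMatrix_le (contractive i 1)) hMc
      (fun f => hop (Sum.inl ⟨i, f⟩)) (fun _ f => hop (Sum.inr ⟨i, f⟩)) a
  obtain ⟨Q, V, hV, hint⟩ := AmalgamatedRep.exists_intertwining π contractive agree M hMc hπ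
  exact ⟨Q, V, fun j => hV _ (hx j), hint⟩

/-- The amalgamated family of representations defined by a covariant representation. -/
abbrev CovariantRep.toAmalgamatedRep (R : CovariantRep τ) :
    AmalgamatedRep.{u, u + 1, u} (petersFamily τ) (petersCoeff τ) where
  H := R.H
  π i := compressionHom (semicrossedProduct_le_diagonalAlgebra _) (R.single i)
  contractive i _ M := norm_opMatrix_compressionHom_le _ (R.single i) M
  agree i j f := (compression_univRep _ f (R.single i)).trans
    (compression_univRep _ f (R.single j)).symm

theorem CovariantRep.toAmalgamatedRep_π_coeff (R : CovariantRep τ) (i : ι) (f : C₀(X, ℂ)) :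
    R.toAmalgamatedRep.π i (petersCoeff τ i f) = R.π f :=
  compression_univRep _ f (R.single i)

theorem CovariantRep.toAmalgamatedRep_π_gen (R : CovariantRep τ) (i : ι) (f : C₀(X, ℂ)) :
    R.toAmalgamatedRep.π i (petersGen τ i f) = R.S i * R.π f :=
  compression_univS_mul_univRep _ () f (R.single i)

/-- A contraction that implements the representation of `petersGen τ i`. -/
theorem AmalgamatedRep.exists_contraction
    (Q : AmalgamatedRep.{u, u + 1, u} (petersFamily τ) (petersCoeff τ)) (i : ι) :
    ∃ S : BOp Q.H, ‖S‖ ≤ 1 ∧ ∀ f, Q.π i (petersGen τ i f) = S * Q.π i (petersCoeff τ i f) :=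
  semicrossedProduct.exists_contraction_map_gen (Q.π i) (Q.norm_le i) ()

/-- The covariant representation defined by an amalgamated family of representations. The index
`i₀` only serves to name the common representation of `C₀(X)`. -/
abbrev AmalgamatedRep.toCovariantRep (i₀ : ι)
    (Q : AmalgamatedRep.{u, u + 1, u} (petersFamily τ) (petersCoeff τ)) : CovariantRep τ where
  H := Q.H
  π := { (Q.π i₀).comp (petersCoeff τ i₀) with
    map_star' := map_star_of_contractive ((Q.π i₀).comp (petersCoeff τ i₀)) fun f =>
      (Q.norm_le i₀ _).trans (semicrossedProduct.norm_coeff_le f) }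
  S i := (Q.exists_contraction i).choose
  norm_S_le i := (Q.exists_contraction i).choose_spec.1
  covariance i f g := by
    have h := (Q.exists_contraction i).choose_spec.2
    change Q.π i₀ (petersCoeff τ i₀ f) * _ * Q.π i₀ (petersCoeff τ i₀ g) =
      _ * Q.π i₀ (petersCoeff τ i₀ (compMul (τ i) f g))
    -- Once the functions act through `Q.π i`, both sides are images under it, and the relation in
    -- `petersFamily τ i` applies.
    rw [Q.agree i₀ i, Q.agree i₀ i, Q.agree i₀ i, mul_assoc, ← h, ← h, ← map_mul,
      semicrossedProduct.coeff_mul_gen]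

theorem AmalgamatedRep.toCovariantRep_π (i₀ : ι)
    (Q : AmalgamatedRep.{u, u + 1, u} (petersFamily τ) (petersCoeff τ)) (f : C₀(X, ℂ)) :
    (Q.toCovariantRep i₀).π f = Q.π i₀ (petersCoeff τ i₀ f) := rfl

theorem AmalgamatedRep.toCovariantRep_S_mul_π (i₀ i : ι)
    (Q : AmalgamatedRep.{u, u + 1, u} (petersFamily τ) (petersCoeff τ)) (f : C₀(X, ℂ)) :
    (Q.toCovariantRep i₀).S i * (Q.toCovariantRep i₀).π f = Q.π i (petersGen τ i f) := by
  rw [Q.toCovariantRep_π, Q.agree i₀ i]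
  exact ((Q.exists_contraction i).choose_spec.2 f).symm

end Peters

/-! ### Domination from intertwining isometries -/

section PairEstimates

variable {J : Type v} {E : J → Type u} [∀ j, NormedAddCommGroup (E j)]
  [∀ j, InnerProductSpace ℂ (E j)] {H : Type*} [NormedAddCommGroup H] [InnerProductSpace ℂ H]
  {I : Type*} {a : I → BOp (lp E 2)} {b : I → BOp H}

/-- Intertwining relations between generators extend to the pair algebra. -/
theorem intertwining_of_mem_pairAlgebra (ha : ∀ i, a i ∈ diagonalAlgebra E) {j : J}
    {V : E j →L[ℂ] H} (hV : ∀ i η, b i (V η) = V (compression E j (a i) η))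
    {p : BOp (lp E 2) × BOp H} (hp : p ∈ pairAlgebra a b) :
    ∀ η, p.2 (V η) = V (compression E j p.1 η) := by
  -- Diagonality is carried along because compression is multiplicative only when the left factor is
  -- diagonal.
  refine (pairAlgebra_induction (p := fun p => p.1 ∈ diagonalAlgebra E ∧
    ∀ η, p.2 (V η) = V (compression E j p.1 η)) ?_ ?_ ?_ ?_ ?_ ?_ hp).2
  · exact fun i => ⟨ha i, hV i⟩
  · exact ⟨zero_mem _, fun η => by simp⟩
  · rintro p q ⟨hp, hp'⟩ ⟨hq, hq'⟩
    refine ⟨add_mem hp hq, fun η => ?_⟩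
    rw [Prod.snd_add, Prod.fst_add, map_add, add_apply, add_apply, map_add, hp', hq']
  · rintro p q ⟨hp, hp'⟩ ⟨hq, hq'⟩
    refine ⟨mul_mem hp hq, fun η => ?_⟩
    rw [Prod.snd_mul, Prod.fst_mul, compression_mul hp]
    change p.2 (q.2 (V η)) = V (compression E j p.1 (compression E j q.1 η))
    rw [hq', hp']
  · rintro c p ⟨hp, hp'⟩
    refine ⟨SMulMemClass.smul_mem c hp, fun η => ?_⟩
    rw [Prod.smul_snd, Prod.smul_fst, map_smul, smul_apply, smul_apply, map_smul, hp']
  · refine (isClosed_diagonalAlgebra.preimage continuous_fst).inter ?_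
    change IsClosed {p : BOp (lp E 2) × BOp H | ∀ η, p.2 (V η) = V (compression E j p.1 η)}
    rw [Set.ofPred_forall]
    refine isClosed_iInter fun η => isClosed_eq ?_ ?_
    · exact (ContinuousLinearMap.apply ℂ H (V η)).continuous.comp continuous_snd
    · exact V.continuous.comp ((ContinuousLinearMap.apply ℂ _ η).continuous.comp
        ((compression E j).continuous.comp continuous_fst))

/-- The second components of the pair algebra are dominated by the first ones if finitely many
vectors always lie in a space that intertwines with a summand. -/
theorem pairDominated_of_intertwining (ha : ∀ i, a i ∈ diagonalAlgebra E)
    (h : ∀ (k : ℕ) (x : Fin k → H), ∃ (j : J) (V : E j →ₗᵢ[ℂ] H), (∀ l, ∃ ξ, V ξ = x l) ∧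
      ∀ i η, b i (V η) = V (compression E j (a i) η)) :
    PairDominated a b := by
  intro k M hM
  refine ContinuousLinearMap.opNorm_le_bound _ (ContinuousLinearMap.opNorm_nonneg _) fun x => ?_
  obtain ⟨j, V, hV, hint⟩ := h k x
  choose ξ hξ using hV
  set y : PiLp 2 (fun _ : Fin k => E j) := WithLp.toLp 2 ξ with hy
  calc ‖opMatrix (M.map Prod.snd) x‖
      ≤ ‖opMatrix ((M.map Prod.fst).map (compression E j)) y‖ := by
        refine PiLp.norm_le_norm_of_coord _ _ fun i => le_of_eq ?_
        rw [opMatrix_apply, opMatrix_apply, ← V.norm_map, map_sum]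
        congr 1
        refine Finset.sum_congr rfl fun l _ => ?_
        rw [← hξ l]
        exact intertwining_of_mem_pairAlgebra (V := V.toContinuousLinearMap) ha hint (hM i l) (ξ l)
    _ ≤ ‖opMatrix ((M.map Prod.fst).map (compression E j))‖ * ‖y‖ :=
        ContinuousLinearMap.le_opNorm _ _
    _ ≤ ‖opMatrix (M.map Prod.fst)‖ * ‖x‖ := by
        refine mul_le_mul (norm_opMatrix_compression_le _ j) ?_ (norm_nonneg _)
          (ContinuousLinearMap.opNorm_nonneg _)
        refine PiLp.norm_le_norm_of_coord _ _ fun i => ?_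
        rw [← hξ i, V.norm_map]

theorem matNorm_le_of_compressionHom_le
    {A : NonUnitalSubalgebra ℂ (BOp (lp E 2))} (hA : A ≤ diagonalAlgebra E) {k : ℕ}
    {M : Matrix (Fin k) (Fin k) A} {C : ℝ} (hC : 0 ≤ C)
    (h : ∀ j, ‖opMatrix (M.map (compressionHom hA j))‖ ≤ C) : matNorm A M ≤ C :=
  norm_opMatrix_le_of_compression_le (fun a b => hA (M a b).2) hC h

end PairEstimates

/-! ### Homomorphisms out of the free product -/

section FreeProductHom

theorem CompletelyContractive.continuous {K : Type*} [NormedAddCommGroup K] [InnerProductSpace ℂ K]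
    {H : Type*} [NormedAddCommGroup H] [InnerProductSpace ℂ H]
    {A : NonUnitalSubalgebra ℂ (BOp K)} {B : NonUnitalSubalgebra ℂ (BOp H)} {φ : A →ₙₐ[ℂ] B}
    (h : CompletelyContractive φ) : Continuous φ :=
  AddMonoidHomClass.continuous_of_bound φ 1 fun a => by
    rw [one_mul]
    exact h.norm_le a

theorem NonUnitalAlgebra.hom_ext_of_eq_topologicalClosure_adjoin {K : Type*}
    [NormedAddCommGroup K] [InnerProductSpace ℂ K] {H : Type*} [NormedAddCommGroup H]
    [InnerProductSpace ℂ H] {A : NonUnitalSubalgebra ℂ (BOp K)} {B : NonUnitalSubalgebra ℂ (BOp H)}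
    {s : Set (BOp K)} (hA : A = (adjoin ℂ s).topologicalClosure) {φ ψ : A →ₙₐ[ℂ] B}
    (hφ : Continuous φ) (hψ : Continuous ψ) (h : ∀ x : A, (x : BOp K) ∈ s → φ x = ψ x) :
    φ = ψ := by
  subst hA
  refine NonUnitalAlgHom.ext fun x => ?_
  refine topologicalClosure_adjoin_induction (p := fun x => φ x = ψ x)
    (fun x hx => h ⟨x, _⟩ hx) ?_ ?_ ?_ ?_ (isClosed_eq hφ hψ) x
  · rw [map_zero, map_zero]
  · intro x y hx hy
    rw [map_add, map_add, hx, hy]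
  · intro x y hx hy
    rw [map_mul, map_mul, hx, hy]
  · intro c x hx
    rw [map_smul, map_smul, hx]

variable {ι : Type} {D : Type u} [NonUnitalRing D] [Module ℂ D]
variable {K : ι → Type v} [∀ i, NormedAddCommGroup (K i)] [∀ i, InnerProductSpace ℂ (K i)]
variable {A : ∀ i, NonUnitalSubalgebra ℂ (BOp (K i))} {δ : ∀ i, D →ₙₐ[ℂ] A i}

theorem freeProduct.hom_ext {H : Type*} [NormedAddCommGroup H] [InnerProductSpace ℂ H]
    {B : NonUnitalSubalgebra ℂ (BOp H)} {φ ψ : freeProduct.{u, v, w} A δ →ₙₐ[ℂ] B}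
    (hφ : Continuous φ) (hψ : Continuous ψ)
    (h : ∀ i a, φ (incl.{u, v, w} A δ i a) = ψ (incl.{u, v, w} A δ i a)) : φ = ψ := by
  refine NonUnitalAlgebra.hom_ext_of_eq_topologicalClosure_adjoin
    (freeProduct_eq_adjoin_range_sigma.{u, v, w} A δ) hφ hψ ?_
  rintro x ⟨⟨i, a⟩, ha⟩
  obtain rfl : incl.{u, v, w} A δ i a = x := Subtype.ext ha
  exact h i a

variable (A δ) in
theorem norm_opMatrix_map_π_le (Q : AmalgamatedRep.{u, v, w} A δ) (i : ι) (k : ℕ)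
    (M : Matrix (Fin k) (Fin k) (A i)) :
    ‖opMatrix (M.map (Q.π i))‖ ≤
      matNorm (freeProduct.{u, v, w} A δ) (M.map (freeProduct.incl.{u, v, w} A δ i)) := by
  refine le_trans (le_of_eq ?_) (norm_opMatrix_compression_le _ Q)
  congr 2
  funext a b
  exact (compression_freeRep A δ i (M a b) Q).symm

/-- By `hπ`, any finite set of test vectors can be moved into a single summand of the free product,
so the images of the generators are dominated. This allows `H` in any universe. Uniqueness holds by
density. -/
theorem freeProduct.existsUnique_hom {H : Type*} [NormedAddCommGroup H] [InnerProductSpace ℂ H]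
    [CompleteSpace H] {B : NonUnitalSubalgebra ℂ (BOp H)} (hB : IsClosed (B : Set (BOp H)))
    (π : ∀ i, A i →ₙₐ[ℂ] B)
    (hπ : ∀ (k : ℕ) (x : Fin k → H), ∃ (Q : AmalgamatedRep.{u, v, w} A δ) (V : Q.H →ₗᵢ[ℂ] H),
      (∀ j, ∃ ξ, V ξ = x j) ∧ ∀ i a ξ, (π i a : BOp H) (V ξ) = V (Q.π i a ξ)) :
    ∃! φ : freeProduct.{u, v, w} A δ →ₙₐ[ℂ] B,
      CompletelyContractive φ ∧ ∀ i a, φ (freeProduct.incl.{u, v, w} A δ i a) = π i a := by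
  let b : (Σ i, A i) → BOp H := fun s => π s.1 s.2
  have hle := pairDominated_of_intertwining (b := b)
    (fun s : Σ i, A i => freeRep_mem_diagonalAlgebra.{u, v, w} A δ s.1 s.2) fun k x => by
      obtain ⟨Q, V, hV, hint⟩ := hπ k x
      refine ⟨Q, V, hV, fun s η => ?_⟩
      rw [compression_freeRep]
      exact hint s.1 s.2 η
  obtain ⟨φ, hφ, -, hφ'⟩ := exists_hom_of_pairAlgebra hle
    (freeProduct_eq_adjoin_range_sigma.{u, v, w} A δ) hB (fun s => (π s.1 s.2).2)
  have hincl : ∀ i a, φ (freeProduct.incl.{u, v, w} A δ i a) = π i a := fun i a =>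
    Subtype.ext (hφ' _ _ (pair_mem_pairAlgebra (b := b) (⟨i, a⟩ : Σ i, A i)))
  exact ⟨φ, ⟨hφ, hincl⟩, fun ψ hψ => freeProduct.hom_ext hψ.1.continuous hφ.continuous
    fun i a => (hψ.2 i a).trans (hincl i a).symm⟩

end FreeProductHom

/-! ### The universal property for Peters' semicrossed products -/

section Peters

variable {X : Type u} [TopologicalSpace X] {ι : Type} (τ : ι → C(X, X))

/-- For the lower bound, each summand `R` of `petersFamily τ i` extends to a covariant
representation of all maps, and the resulting summand of the free product restricts to the
compression to `R`. -/
theorem completelyIsometric_incl_peters (i : ι) : CompletelyIsometric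
    (freeProduct.incl.{u, u + 1, u} (petersFamily τ) (petersCoeff τ) i) := by
  intro k M
  refine le_antisymm (matNorm_incl_le (petersFamily τ) (petersCoeff τ) i k M) ?_
  refine matNorm_le_of_compressionHom_le (semicrossedProduct_le_diagonalAlgebra _)
    (ContinuousLinearMap.opNorm_nonneg _) fun R => ?_
  obtain ⟨R, rfl⟩ := R.exists_single_eq (τ := τ) i
  exact norm_opMatrix_map_π_le (petersFamily τ) (petersCoeff τ) R.toAmalgamatedRep i k M

theorem isAmalgamatedFreeProduct_peters : IsAmalgamatedFreeProduct.{u, u + 1, v}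
    (petersFamily τ) (petersCoeff τ) (freeProduct.{u, u + 1, u} (petersFamily τ) (petersCoeff τ))
    (freeProduct.incl.{u, u + 1, u} (petersFamily τ) (petersCoeff τ)) := by
  refine ⟨NonUnitalSubalgebra.isClosed_topologicalClosure _, completelyIsometric_incl_peters τ,
    fun i j f => Subtype.ext (freeRep_agree _ _ i j f), ?_⟩
  intro H _ _ _ B hB π hπ hagree
  exact freeProduct.existsUnique_hom hB π fun k x =>
    exists_amalgamatedRep_intertwining
      (fun i => (NonUnitalSubalgebraClass.subtype B).comp (π i)) (fun i k M => hπ i k M)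
      (fun i j f => congrArg Subtype.val (hagree i j f)) x

end Peters

/-! ### Comparison of direct sums with matching summands -/

section Summands

variable {I : Type*} {J : Type v} {E : J → Type u} [∀ j, NormedAddCommGroup (E j)]
  [∀ j, InnerProductSpace ℂ (E j)] {J' : Type*} {E' : J' → Type*}
  [∀ j, NormedAddCommGroup (E' j)] [∀ j, InnerProductSpace ℂ (E' j)]
  {c : I → BOp (lp E 2)} {d : I → BOp (lp E' 2)}

open Classical in
theorem apply_single_of_mem_diagonalAlgebra {T : BOp (lp E 2)} (hT : T ∈ diagonalAlgebra E) (j : J)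
    (ξ : E j) : T (lp.single 2 j ξ) = lp.single 2 j (compression E j T ξ) := by
  ext l
  by_cases h : l = j
  · subst h
    rw [lp.single_apply_self, compression_apply]
  · rw [hT l, lp.single_apply_ne _ _ _ h, lp.single_apply_ne _ _ _ h, lp.single_zero, map_zero]
    rfl

/-- Each summand on the right side being equivalent to a summand on the left side, the right side
is dominated by the left side. -/
theorem pairDominated_of_summands (hc : ∀ i, c i ∈ diagonalAlgebra E)
    (hd : ∀ i, d i ∈ diagonalAlgebra E')
    (h : ∀ j', ∃ (j : J) (U : E j ≃ₗᵢ[ℂ] E' j'), ∀ i η,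
      compression E' j' (d i) (U η) = U (compression E j (c i) η)) :
    PairDominated c d := by
  intro k M hM
  classical
  refine norm_opMatrix_le_of_compression_le
    (fun i j => snd_mem_of_mem_pairAlgebra isClosed_diagonalAlgebra hd (hM i j))
    (ContinuousLinearMap.opNorm_nonneg _) fun j' => ?_
  obtain ⟨j, U, hU⟩ := h j'
  let W : E j →L[ℂ] E' j' := U.toLinearIsometry.toContinuousLinearMap
  -- Placing `E j` inside the target direct sum turns the equivalence of summands into an
  -- intertwining relation, which extends from the generators to the pair algebra.
  let V : E j →L[ℂ] lp E' 2 := lp.singleContinuousLinearMap ℂ E' 2 j' ∘L W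
  have hV : ∀ i η, d i (V η) = V (compression E j (c i) η) := fun i η => by
    refine (apply_single_of_mem_diagonalAlgebra (hd i) j' (U η)).trans ?_
    rw [hU]
    rfl
  have key : ∀ p ∈ pairAlgebra c d, ∀ ξ,
      compression E' j' p.2 ξ = U (compression E j p.1 (U.symm ξ)) := fun p hp ξ => by
    have h1 := congrArg (fun x : lp E' 2 => x j')
      (intertwining_of_mem_pairAlgebra hc hV hp (U.symm ξ))
    have h2 : V (U.symm ξ) = lp.single 2 j' ξ :=
      congrArg (lp.single 2 j') (U.apply_symm_apply ξ)
    rw [compression_apply, ← h2]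
    exact h1.trans (lp.single_apply_self _ _ _)
  refine le_trans (le_of_eq ?_) ((norm_opMatrix_compress_le ((M.map Prod.fst).map
    (compression E j)) W (fun x => (U.norm_map x).le)
      U.symm.toLinearIsometry.toContinuousLinearMap (fun x => (U.symm.norm_map x).le)).trans
    (norm_opMatrix_compression_le _ j))
  congr 2
  funext x y
  exact ContinuousLinearMap.ext (key _ (hM x y))

end Summands

/-! ### The completely isometric isomorphism -/

section Isomorphism

/-- A completely isometric homomorphism on a norm closed algebra is surjective if its range contains
generators. -/
theorem CompletelyIsometric.surjective {K : Type*} [NormedAddCommGroup K]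
    [InnerProductSpace ℂ K] [CompleteSpace K] {H : Type*} [NormedAddCommGroup H]
    [InnerProductSpace ℂ H] {A : NonUnitalSubalgebra ℂ (BOp K)}
    {B : NonUnitalSubalgebra ℂ (BOp H)} (hA : IsClosed (A : Set (BOp K))) {φ : A →ₙₐ[ℂ] B}
    (h : CompletelyIsometric φ) {s : Set (BOp H)}
    (hB : ∀ B' : NonUnitalSubalgebra ℂ (BOp H), IsClosed (B' : Set (BOp H)) → s ⊆ B' → B ≤ B')
    (hs : ∀ y ∈ s, ∃ a, (φ a : BOp H) = y) : Function.Surjective φ := by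
  have : CompleteSpace A := hA.completeSpace_coe
  have hn : ∀ a, ‖(φ a : BOp H)‖ = ‖a‖ := fun a =>
    (norm_opMatrix_one (φ a : BOp H)).symm.trans
      ((h 1 fun _ _ => a).trans (norm_opMatrix_one (a : BOp K)))
  let ψ : A →ₙₐ[ℂ] BOp H := (NonUnitalSubalgebraClass.subtype B).comp φ
  have hi : Isometry ψ := AddMonoidHomClass.isometry_of_norm ψ hn
  have hle : B ≤ NonUnitalAlgHom.range ψ :=
    hB _ hi.isClosedEmbedding.isClosed_range hs
  intro y
  obtain ⟨x, hx⟩ := hle y.2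
  exact ⟨x, Subtype.ext hx⟩

/-- Mapping `a i` to `b i` extends to a completely isometric isomorphism if the matrix norms over
`pairAlgebra a b` agree. -/
theorem exists_completelyIsometric_of_pairDominated {K : Type*} [NormedAddCommGroup K]
    [InnerProductSpace ℂ K] [CompleteSpace K] {H : Type*} [NormedAddCommGroup H]
    [InnerProductSpace ℂ H] [CompleteSpace H] {I : Type*} {a : I → BOp K} {b : I → BOp H}
    (hab : PairDominated a b) (hba : PairDominated b a) {A : NonUnitalSubalgebra ℂ (BOp K)}
    (hA : A = (NonUnitalAlgebra.adjoin ℂ (Set.range a)).topologicalClosure)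
    {B : NonUnitalSubalgebra ℂ (BOp H)} (hB : IsClosed (B : Set (BOp H))) (hb : ∀ i, b i ∈ B)
    (hmin : ∀ B' : NonUnitalSubalgebra ℂ (BOp H), IsClosed (B' : Set (BOp H)) →
      Set.range b ⊆ B' → B ≤ B') :
    ∃ φ : A →ₙₐ[ℂ] B, CompletelyIsometric φ ∧ Function.Surjective φ ∧
      ∀ i (x : A), (x : BOp K) = a i → (φ x : BOp H) = b i := by
  obtain ⟨φ, hφ, hpair, huniq⟩ := exists_hom_of_pairAlgebra hab hA hB hb
  -- The reverse inequality is the opposite domination, applied to the swapped pairs of the graph.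
  have hiso : CompletelyIsometric φ := fun k M => le_antisymm (hφ k M) <|
    hba k (M.map fun x => ((φ x : BOp H), (x : BOp K))) fun i j => swap_mem_pairAlgebra (hpair _)
  have hgen : ∀ i (x : A), (x : BOp K) = a i → (φ x : BOp H) = b i := fun i x hx =>
    huniq x (b i) (hx ▸ pair_mem_pairAlgebra i)
  have hAc : IsClosed (A : Set (BOp K)) := by
    rw [hA]
    exact NonUnitalSubalgebra.isClosed_topologicalClosure _
  have ha : ∀ i, a i ∈ A := fun i => by
    rw [hA]
    exact NonUnitalSubalgebra.le_topologicalClosure _ (NonUnitalAlgebra.subset_adjoin ℂ ⟨i, rfl⟩)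
  refine ⟨φ, hiso, hiso.surjective hAc hmin ?_, hgen⟩
  rintro _ ⟨i, rfl⟩
  exact ⟨⟨a i, ha i⟩, hgen i _ rfl⟩

theorem semicrossedProduct.map_mem_of_generators {X : Type u} [TopologicalSpace X] {ι : Type}
    {τ : ι → C(X, X)} {H : Type v} [NormedAddCommGroup H] [InnerProductSpace ℂ H]
    {ρ : semicrossedProduct τ →ₙₐ[ℂ] BOp H} (hρ : Continuous ρ) {B : NonUnitalSubalgebra ℂ (BOp H)}
    (hB : IsClosed (B : Set (BOp H))) (hcoeff : ∀ f, ρ (coeff τ f) ∈ B)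
    (hgen : ∀ i f, ρ (gen τ i f) ∈ B) (a : semicrossedProduct τ) : ρ a ∈ B := by
  refine semicrossedProduct.induction (p := fun a => ρ a ∈ B) hcoeff hgen ?_ ?_ ?_
    (hB.preimage hρ) a
  · intro x y hx hy
    rw [map_add]
    exact add_mem hx hy
  · intro x y hx hy
    rw [map_mul]
    exact mul_mem hx hy
  · intro c x hx
    rw [map_smul]
    exact SMulMemClass.smul_mem c hx

section FreeProduct

variable {ι : Type} {D : Type u} [NonUnitalRing D] [Module ℂ D]
  {K : ι → Type v} [∀ i, NormedAddCommGroup (K i)] [∀ i, InnerProductSpace ℂ (K i)]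
  (A : ∀ i, NonUnitalSubalgebra ℂ (BOp (K i))) (δ : ∀ i, D →ₙₐ[ℂ] A i)

theorem isClosed_freeProduct : IsClosed (freeProduct.{u, v, w} A δ :
    Set (BOp (lp (fun R : AmalgamatedRep.{u, v, w} A δ => R.H) 2))) :=
  NonUnitalSubalgebra.isClosed_topologicalClosure _

theorem freeProduct_le {B : NonUnitalSubalgebra ℂ
      (BOp (lp (fun R : AmalgamatedRep.{u, v, w} A δ => R.H) 2))}
    (hB : IsClosed (B : Set (BOp (lp (fun R : AmalgamatedRep.{u, v, w} A δ => R.H) 2))))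
    (h : ∀ i a, freeRep.{u, v, w} A δ i a ∈ B) : freeProduct.{u, v, w} A δ ≤ B := by
  refine NonUnitalAlgebra.topologicalClosure_adjoin_le (Set.iUnion_subset fun i => ?_) hB
  rintro _ ⟨a, rfl⟩
  exact h i a

theorem continuous_freeRep (i : ι) : Continuous (freeRep.{u, v, w} A δ i) :=
  AddMonoidHomClass.continuous_of_bound _ 1 fun a => by
    rw [one_mul]
    exact norm_freeRep_le A δ i a

end FreeProduct

variable {X : Type u} [TopologicalSpace X] {ι : Type} (τ : ι → C(X, X))

/-- The generators of the semicrossed product. -/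
def semicrossedGenerators : C₀(X, ℂ) ⊕ (Σ _ : ι, C₀(X, ℂ)) → BOp (UniversalSpace τ) :=
  Sum.elim (univRep τ) fun s => univS τ s.1 * univRep τ s.2

/-- The corresponding elements of the free product. -/
def freeGenerators (i₀ : ι) : C₀(X, ℂ) ⊕ (Σ _ : ι, C₀(X, ℂ)) →
    BOp (lp (fun Q : AmalgamatedRep.{u, u + 1, u} (petersFamily τ) (petersCoeff τ) => Q.H) 2) :=
  Sum.elim (fun f => freeRep.{u, u + 1, u} (petersFamily τ) (petersCoeff τ) i₀ (petersCoeff τ i₀ f))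
    fun s => freeRep.{u, u + 1, u} (petersFamily τ) (petersCoeff τ) s.1 (petersGen τ s.1 s.2)

theorem semicrossedProduct_eq_adjoin_generators : semicrossedProduct τ =
    (NonUnitalAlgebra.adjoin ℂ (Set.range (semicrossedGenerators τ))).topologicalClosure := by
  rw [semicrossedProduct, semicrossedGenerators, Set.Sum.elim_range,
    Set.range_sigma_eq_iUnion_range]

theorem semicrossedGenerators_mem_diagonalAlgebra (s : C₀(X, ℂ) ⊕ (Σ _ : ι, C₀(X, ℂ))) :
    semicrossedGenerators τ s ∈ diagonalAlgebra (fun R : CovariantRep τ => R.H) := by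
  obtain f | ⟨i, f⟩ := s
  · exact univRep_mem_diagonalAlgebra τ f
  · exact mul_mem (univS_mem_diagonalAlgebra τ i) (univRep_mem_diagonalAlgebra τ f)

theorem freeGenerators_mem_diagonalAlgebra (i₀ : ι) (s : C₀(X, ℂ) ⊕ (Σ _ : ι, C₀(X, ℂ))) :
    freeGenerators τ i₀ s ∈ diagonalAlgebra
      (fun Q : AmalgamatedRep.{u, u + 1, u} (petersFamily τ) (petersCoeff τ) => Q.H) := by
  obtain f | ⟨i, f⟩ := s
  · exact freeRep_mem_diagonalAlgebra (petersFamily τ) (petersCoeff τ) i₀ _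
  · exact freeRep_mem_diagonalAlgebra (petersFamily τ) (petersCoeff τ) i _

/-- One half of the dictionary: every summand of the free product already occurs, with the same
operators on the same space, in the semicrossed product. `compression_semicrossedGenerators` is the
other half. -/
theorem compression_freeGenerators (i₀ : ι)
    (Q : AmalgamatedRep.{u, u + 1, u} (petersFamily τ) (petersCoeff τ))
    (s : C₀(X, ℂ) ⊕ (Σ _ : ι, C₀(X, ℂ))) :
    compression (fun Q : AmalgamatedRep.{u, u + 1, u} (petersFamily τ) (petersCoeff τ) => Q.H) Q
      (freeGenerators τ i₀ s) =
    compression (fun R : CovariantRep τ => R.H) (Q.toCovariantRep i₀)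
      (semicrossedGenerators τ s) := by
  obtain f | ⟨i, f⟩ := s
  · exact (compression_freeRep (petersFamily τ) (petersCoeff τ) i₀ _ Q).trans
      (compression_univRep τ f (Q.toCovariantRep i₀)).symm
  · exact (compression_freeRep (petersFamily τ) (petersCoeff τ) i _ Q).trans
      ((Q.toCovariantRep_S_mul_π i₀ i f).symm.trans
        (compression_univS_mul_univRep τ i f (Q.toCovariantRep i₀)).symm)

theorem compression_semicrossedGenerators (i₀ : ι) (R : CovariantRep τ)
    (s : C₀(X, ℂ) ⊕ (Σ _ : ι, C₀(X, ℂ))) :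
    compression (fun R : CovariantRep τ => R.H) R (semicrossedGenerators τ s) =
    compression (fun Q : AmalgamatedRep.{u, u + 1, u} (petersFamily τ) (petersCoeff τ) => Q.H)
      R.toAmalgamatedRep (freeGenerators τ i₀ s) := by
  obtain f | ⟨i, f⟩ := s
  · exact (compression_univRep τ f R).trans ((R.toAmalgamatedRep_π_coeff i₀ f).symm.trans
      (compression_freeRep (petersFamily τ) (petersCoeff τ) i₀ _ R.toAmalgamatedRep).symm)
  · exact (compression_univS_mul_univRep τ i f R).trans ((R.toAmalgamatedRep_π_gen i f).symm.trans
      (compression_freeRep (petersFamily τ) (petersCoeff τ) i _ R.toAmalgamatedRep).symm)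

/-- The free product is generated by the functions and the elements `petersGen τ i f`. -/
theorem freeProduct_le_of_freeGenerators_mem (i₀ : ι) (B : NonUnitalSubalgebra ℂ
      (BOp (lp (fun Q : AmalgamatedRep.{u, u + 1, u} (petersFamily τ) (petersCoeff τ) => Q.H) 2)))
    (hB : IsClosed (B : Set
      (BOp (lp (fun Q : AmalgamatedRep.{u, u + 1, u} (petersFamily τ) (petersCoeff τ) => Q.H) 2))))
    (h : Set.range (freeGenerators τ i₀) ⊆ B) :
    freeProduct.{u, u + 1, u} (petersFamily τ) (petersCoeff τ) ≤ B := by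
  refine freeProduct_le (petersFamily τ) (petersCoeff τ) hB fun i a => ?_
  refine semicrossedProduct.map_mem_of_generators
    (continuous_freeRep (petersFamily τ) (petersCoeff τ) i) hB (fun f => ?_)
    (fun _ f => h ⟨Sum.inr ⟨i, f⟩, rfl⟩) a
  rw [freeRep_agree (petersFamily τ) (petersCoeff τ) i i₀ f]
  exact h ⟨Sum.inl f, rfl⟩

theorem pairDominated_freeGenerators (i₀ : ι) :
    PairDominated (semicrossedGenerators τ) (freeGenerators τ i₀) :=
  pairDominated_of_summands (semicrossedGenerators_mem_diagonalAlgebra τ)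
    (freeGenerators_mem_diagonalAlgebra τ i₀) fun Q =>
      ⟨Q.toCovariantRep i₀, LinearIsometryEquiv.refl ℂ Q.H, fun s η =>
        DFunLike.congr_fun (compression_freeGenerators τ i₀ Q s) η⟩

theorem pairDominated_semicrossedGenerators (i₀ : ι) :
    PairDominated (freeGenerators τ i₀) (semicrossedGenerators τ) :=
  pairDominated_of_summands (freeGenerators_mem_diagonalAlgebra τ i₀)
    (semicrossedGenerators_mem_diagonalAlgebra τ) fun R =>
      ⟨R.toAmalgamatedRep, LinearIsometryEquiv.refl ℂ R.H, fun s η =>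
        DFunLike.congr_fun (compression_semicrossedGenerators τ i₀ R s) η⟩

theorem freeGenerators_mem_freeProduct (i₀ : ι) (s : C₀(X, ℂ) ⊕ (Σ _ : ι, C₀(X, ℂ))) :
    freeGenerators τ i₀ s ∈ freeProduct.{u, u + 1, u} (petersFamily τ) (petersCoeff τ) := by
  obtain f | ⟨i, f⟩ := s
  · exact freeRep_mem (petersFamily τ) (petersCoeff τ) i₀ _
  · exact freeRep_mem (petersFamily τ) (petersCoeff τ) i _

theorem exists_completelyIsometric_semicrossedProduct (i₀ : ι) :
    ∃ Φ : semicrossedProduct τ →ₙₐ[ℂ]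
        freeProduct.{u, u + 1, u} (petersFamily τ) (petersCoeff τ),
      CompletelyIsometric Φ ∧ Function.Surjective Φ ∧
      (∀ i f, Φ (semicrossedProduct.coeff τ f) =
        freeProduct.incl.{u, u + 1, u} (petersFamily τ) (petersCoeff τ) i (petersCoeff τ i f)) ∧
      ∀ i f, Φ (semicrossedProduct.gen τ i f) =
        freeProduct.incl.{u, u + 1, u} (petersFamily τ) (petersCoeff τ) i (petersGen τ i f) := by
  have hex := exists_completelyIsometric_of_pairDominated
    (pairDominated_freeGenerators τ i₀) (pairDominated_semicrossedGenerators τ i₀)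
    (semicrossedProduct_eq_adjoin_generators τ)
    (isClosed_freeProduct (petersFamily τ) (petersCoeff τ))
    (freeGenerators_mem_freeProduct τ i₀) (freeProduct_le_of_freeGenerators_mem τ i₀)
  obtain ⟨Φ, hiso, hsurj, huniq⟩ := hex
  have hcoeff : ∀ f, Φ (semicrossedProduct.coeff τ f) =
      freeProduct.incl.{u, u + 1, u} (petersFamily τ) (petersCoeff τ) i₀ (petersCoeff τ i₀ f) :=
    fun f => Subtype.ext (huniq (Sum.inl f) _ rfl)
  have hgen : ∀ i f, Φ (semicrossedProduct.gen τ i f) =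
      freeProduct.incl.{u, u + 1, u} (petersFamily τ) (petersCoeff τ) i (petersGen τ i f) :=
    fun i f => Subtype.ext (huniq (Sum.inr ⟨i, f⟩) _ rfl)
  exact ⟨Φ, hiso, hsurj, fun i f => (hcoeff f).trans
    (Subtype.ext (freeRep_agree (petersFamily τ) (petersCoeff τ) i₀ i f)), hgen⟩

end Isomorphism

end

theorem theorem2 {X : Type u} [TopologicalSpace X] [LocallyCompactSpace X] [T2Space X]
    {n : ℕ} (hn : 1 ≤ n) (τ : Fin n → C(X, X)) :
    IsAmalgamatedFreeProduct.{u, u + 1, v}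
      (fun i => petersSemicrossedProduct (τ i))
      (fun i => semicrossedProduct.coeff fun _ : Unit => τ i)
      (freeProduct.{u, u + 1, u}
        (fun i => petersSemicrossedProduct (τ i))
        (fun i => semicrossedProduct.coeff fun _ : Unit => τ i))
      (freeProduct.incl.{u, u + 1, u}
        (fun i => petersSemicrossedProduct (τ i))
        (fun i => semicrossedProduct.coeff fun _ : Unit => τ i)) ∧
    ∃ Φ : semicrossedProduct τ →ₙₐ[ℂ]
        freeProduct.{u, u + 1, u}
          (fun i => petersSemicrossedProduct (τ i))
          (fun i => semicrossedProduct.coeff fun _ : Unit => τ i),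
      CompletelyIsometric Φ ∧ Function.Surjective Φ ∧
      (∀ i f, Φ (semicrossedProduct.coeff τ f) =
        freeProduct.incl.{u, u + 1, u} _ _ i (semicrossedProduct.coeff (fun _ : Unit => τ i) f)) ∧
      ∀ i f, Φ (semicrossedProduct.gen τ i f) =
        freeProduct.incl.{u, u + 1, u} _ _ i
          (semicrossedProduct.gen (fun _ : Unit => τ i) () f) :=
  ⟨isAmalgamatedFreeProduct_peters τ,
    -- `hn` supplies an index through which `C₀(X)` enters the free product. A free product of no
    -- algebras would be zero.
    exists_completelyIsometric_semicrossedProduct τ ⟨0, hn⟩⟩
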